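/- **Conventions.** An *enhanced 2-category* $K$ is a strict 2-category (its 1-cells are called *loose*) with a wide, locally full sub-2-category of *tight* 1-cells; "maps" are loose unless said otherwise, and pullbacks are strict 2-pullbacks. A map $p:E\to B$ is a *discrete opfibration* if for all $e:X\to E$, $b:X\to B$ and $\varphi:pe\Rightarrow b$ there is a unique 2-cell $\lambda$ with source $e$ and $p\lambda=\varphi$. A *left-tight pullback* of a tight map $p:E\to B$ along a map $f:A\to B$ is a pullback whose projection to $A$ is tight and detects tightness ($h$ is tight whenever its composite with this projection is). A *plumbus* is an enhanced 2-category having a tight terminal object (a 2-terminal object $1$ such that all maps $X\to 1$ are tight) and left-tight pullbacks of all tight discrete opfibrations along all maps, and in which tight discrete opfibrations detect tightness ($e$ is tight whenever $pe$ is, for $p$ a tight discrete opfibration). A *representable plumbus* is a plumbus $K$ with a class of tight discrete opfibrations, called *small*, that is stable under left-tight pullback and under isomorphism over the base (among tight discrete opfibrations) and contains $\mathrm{id}_1$, together with a small discrete opfibration $u:\Omega_\bullet\to\Omega$, its *2-classifier*, such that for every $B$ the functor $f\mapsto f^*u$ from $K(B,\Omega)$ to the full subcategory of $K/B$ on the tight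 discrete opfibrations is fully faithful with essential image the small ones. A 2-cell $\varphi:f\Rightarrow g$ in $K(B,\Omega)$ is said to *classify* the map $f^*u\to g^*u$ over $B$ that it is sent to. A *classifying map* of a small $p:E\to B$ is a map $d:B\to\Omega$ for which there is a map $x:E\to\Omega_\bullet$ such that $(p,x)$ is a pullback of $u$ along $d$; $p$ is *perfect* if it has a tight classifying map. An *enhanced 2-monad* $(T,i,m)$ on $K$ is a strict 2-monad such that $T$ preserves tightness and the components of $i$ and $m$ are tight. $\mathrm{Alg}_{\mathrm{lx}}(T)$ is the enhanced 2-category of strict $T$-algebras with tight structure map, lax $T$-morphisms $(f,\bar f)$, with laxator $\bar f:\beta\,Tf\Rightarrow f\alpha$ satisfying the unit and multiplication laws, and $T$-2-morphisms; a lax morphism is tight when it is strict and its underlying map is tight. For a strict morphism $p:(E,\eta)\to(B,\beta)$ its *$T$-cartesianity defect* is the comparison map $\delta_p:TE\to\beta^*E$ into the pullback of $p$ along $\beta$, induced by $Tp$ and $\eta$. **Theorem.** Let $K$ be a representable plumbus with 2-classifier $u:\Omega_\bullet\to\Omega$ and let $(T,i,m)$ be an enhanced 2-monad on $K$ such that -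 (A) $Tu$ is a small discrete opfibration; - (B) $T$ preserves pullbacks of $u$ (it sends left-tight pullbacks of $u$ along arbitrary maps to pullbacks); - (C) the naturality squares of $i$ and of $m$ at $u$ are pullbacks; - (D) $Tu$ is perfect, with a tight classifying map $\omega:T\Omega\to\Omega$; - (E) $(\Omega,\omega)$ is a strict $T$-algebra. Let $\omega_\bullet:T\Omega_\bullet\to\Omega_\bullet$ be any map such that $(Tu,\omega_\bullet)$ is a pullback of $u$ along $\omega$. Then $\omega_\bullet$ is a tight strict $T$-algebra structure, so that $u:(\Omega_\bullet,\omega_\bullet)\to(\Omega,\omega)$ is a strict $T$-morphism, and: 1. $\mathrm{Alg}_{\mathrm{lx}}(T)$ is a representable plumbus with 2-classifier $u:(\Omega_\bullet,\omega_\bullet)\to(\Omega,\omega)$, where a tight discrete opfibration of $\mathrm{Alg}_{\mathrm{lx}}(T)$ is small exactly when its underlying map is small in $K$. 2. Let $p:(E,\eta)\to(B,\beta)$ be a small discrete opfibration in $\mathrm{Alg}_{\mathrm{lx}}(T)$. If $d:B\to\Omega$ and $x:E\to\Omega_\bullet$ are such that $(p,x)$ is a pullback of $u$ along $d$ in $K$,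 then there is a unique laxator $\bar d$ such that $(d,\bar d)$ is a lax $T$-morphism and, for some lax $T$-morphism structure on $x$, $(p,x)$ is a pullback of $u$ along $(d,\bar d)$ in $\mathrm{Alg}_{\mathrm{lx}}(T)$. Moreover, for every such pullback in $\mathrm{Alg}_{\mathrm{lx}}(T)$, $(Tp,\ \omega_\bullet\,Tx)$ is a pullback of $u$ along $\omega\,Td$, the pullback $\beta^*E\to TB$ of $p$ along $\beta$ (with $\beta^*E\to E\xrightarrow{x}\Omega_\bullet$) is a pullback of $u$ along $d\beta$, and with respect to these the laxator $\bar d:\omega\,Td\Rightarrow d\beta$ classifies the $T$-cartesianity defect $\delta_p:TE\to\beta^*E$. -/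

import Mathlib

open CategoryTheory Bicategory

universe w v u

namespace Plumbus

section Strictness

variable {K : Type u} [Bicategory.{w, v} K]

/-- Equality of 2-cells of a strict 2-category whose boundaries are equal, but possibly not
definitionally so: `η ≗ θ` means that `η` and `θ` have the same source and the same target and
that they are equal along these identifications. -/
def TwoCellEq {a b : K} {f g f' g' : a ⟶ b} (η : f ⟶ g) (θ : f' ⟶ g') : Prop :=
  ∃ (hf : f = f') (hg : g = g'), η = eqToHom hf ≫ θ ≫ eqToHom hg.symm

infix:50 " ≗ " => TwoCellEq

namespace TwoCellEq

variable {a b c d : K}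

theorem refl {f g : a ⟶ b} (η : f ⟶ g) : η ≗ η := ⟨rfl, rfl, by simp⟩

theorem of_eq {f g : a ⟶ b} {η θ : f ⟶ g} (h : η = θ) : η ≗ θ := h ▸ refl η

theorem symm {f g f' g' : a ⟶ b} {η : f ⟶ g} {θ : f' ⟶ g'} (h : η ≗ θ) : θ ≗ η := by
  obtain ⟨rfl, rfl, h⟩ := h
  exact ⟨rfl, rfl, by simp [h]⟩

theorem trans {f g f' g' f'' g'' : a ⟶ b} {η : f ⟶ g} {θ : f' ⟶ g'} {κ : f'' ⟶ g''}
    (h : η ≗ θ) (h' : θ ≗ κ) : η ≗ κ := by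
  obtain ⟨rfl, rfl, h⟩ := h
  obtain ⟨rfl, rfl, h'⟩ := h'
  exact ⟨rfl, rfl, by simp [h, h']⟩

theorem eq {f g : a ⟶ b} {η θ : f ⟶ g} (h : η ≗ θ) : η = θ := by
  obtain ⟨_, _, h⟩ := h
  simpa using h

theorem eqToHom_left {f f' g : a ⟶ b} (h : f = f') (η : f' ⟶ g) : eqToHom h ≫ η ≗ η := by
  subst h; exact of_eq (by simp)

theorem eqToHom_right {f g g' : a ⟶ b} (h : g = g') (η : f ⟶ g) : η ≫ eqToHom h ≗ η := by
  subst h; exact of_eq (by simp)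

theorem eqToHom_id {f f' : a ⟶ b} (h : f = f') : eqToHom h ≗ 𝟙 f := by
  subst h; exact refl _

theorem id_congr {f f' : a ⟶ b} (h : f = f') : 𝟙 f ≗ 𝟙 f' := by
  subst h; exact refl _

/-- Composites across an identification of 1-cells respect `≗`. -/
theorem comp {f g f' g' : a ⟶ b} {k h k' h' : a ⟶ b} {η : f ⟶ g} {θ : k ⟶ h} {η' : f' ⟶ g'}
    {θ' : k' ⟶ h'} (e : g = k) (e' : g' = k') (h₁ : η ≗ η') (h₂ : θ ≗ θ') :
    η ≫ eqToHom e ≫ θ ≗ η' ≫ eqToHom e' ≫ θ' := by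
  obtain ⟨rfl, rfl, rfl⟩ := h₁
  obtain ⟨rfl, rfl, rfl⟩ := h₂
  exact of_eq (by simp)

theorem src {f g f' g' : a ⟶ b} {η : f ⟶ g} {θ : f' ⟶ g'} (h : η ≗ θ) : f = f' := h.1

theorem tgt {f g f' g' : a ⟶ b} {η : f ⟶ g} {θ : f' ⟶ g'} (h : η ≗ θ) : g = g' := h.2.1

theorem compMid {f g f' g' : a ⟶ b} {k h k' h' : a ⟶ b} {η : f ⟶ g} {θ : k ⟶ h} {η' : f' ⟶ g'}
    {θ' : k' ⟶ h'} {e : g = k} (h₁ : η ≗ η') (h₂ : θ ≗ θ') :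
    η ≫ eqToHom e ≫ θ ≗ η' ≫ eqToHom (h₁.tgt.symm.trans (e.trans h₂.src)) ≫ θ' :=
  comp _ _ h₁ h₂

theorem compMid' {f g f' g' : a ⟶ b} {h k' h' : a ⟶ b} {η : f ⟶ g} {θ : g ⟶ h} {η' : f' ⟶ g'}
    {θ' : k' ⟶ h'} (h₁ : η ≗ η') (h₂ : θ ≗ θ') :
    η ≫ θ ≗ η' ≫ eqToHom (h₁.tgt.symm.trans h₂.src) ≫ θ' :=
  (of_eq (by simp)).trans (compMid (e := rfl) h₁ h₂)

theorem whiskerLeft_mid (p : a ⟶ b) {f g h k : b ⟶ c} (η : f ⟶ g) (θ : h ⟶ k) (e : g = h) :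
    p ◁ (η ≫ eqToHom e ≫ θ) ≗ p ◁ η ≫ eqToHom (congrArg (p ≫ ·) e) ≫ p ◁ θ := by
  subst e
  exact of_eq (by simp)

theorem whiskerRight_mid {f g h k : a ⟶ b} (η : f ⟶ g) (θ : h ⟶ k) (e : g = h) (p : b ⟶ c) :
    (η ≫ eqToHom e ≫ θ) ▷ p ≗ η ▷ p ≫ eqToHom (congrArg (· ≫ p) e) ≫ θ ▷ p := by
  subst e
  exact of_eq (by simp)

theorem map₂_mid {L : Type*} [Bicategory L] (T : StrictPseudofunctor K L) {f g h k : a ⟶ b}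
    (η : f ⟶ g) (θ : h ⟶ k) (e : g = h) :
    T.map₂ (η ≫ eqToHom e ≫ θ) ≗ T.map₂ η ≫ eqToHom (congrArg T.map e) ≫ T.map₂ θ := by
  subst e
  exact of_eq (by simp)

theorem exchange {f g : a ⟶ b} {h i : b ⟶ c} (η : f ⟶ g) (θ : h ⟶ i) :
    (f ◁ θ) ≫ eqToHom rfl ≫ (η ▷ i) ≗ (η ▷ h) ≫ eqToHom rfl ≫ (g ◁ θ) :=
  of_eq (by simpa using whisker_exchange η θ)

theorem comp' {f g f' g' : a ⟶ b} {h h' : a ⟶ b} {η : f ⟶ g} {θ : g ⟶ h} {η' : f' ⟶ g'}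
    {θ' : g' ⟶ h'} (h₁ : η ≗ η') (h₂ : θ ≗ θ') : η ≫ θ ≗ η' ≫ θ' := by
  simpa using comp rfl rfl h₁ h₂

theorem whiskerLeft {f f' : a ⟶ b} (e : f = f') {g h g' h' : b ⟶ c} {η : g ⟶ h} {η' : g' ⟶ h'}
    (H : η ≗ η') : f ◁ η ≗ f' ◁ η' := by
  subst e
  obtain ⟨rfl, rfl, rfl⟩ := H
  exact of_eq (by simp)

theorem whiskerRight {f f' : b ⟶ c} (e : f = f') {g h g' h' : a ⟶ b} {η : g ⟶ h} {η' : g' ⟶ h'}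
    (H : η ≗ η') : η ▷ f ≗ η' ▷ f' := by
  subst e
  obtain ⟨rfl, rfl, rfl⟩ := H
  exact of_eq (by simp)

theorem map₂ {L : Type*} [Bicategory L] (T : StrictPseudofunctor K L) {f g f' g' : a ⟶ b}
    {η : f ⟶ g} {θ : f' ⟶ g'} (h : η ≗ θ) : T.map₂ η ≗ T.map₂ θ := by
  obtain ⟨rfl, rfl, rfl⟩ := h
  exact of_eq (by simp)

variable [Strict K]

theorem assoc_left (f : a ⟶ b) (g : b ⟶ c) {h k : c ⟶ d} (η : h ⟶ k) :
    (f ≫ g) ◁ η ≗ f ◁ g ◁ η := by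
  refine ⟨Strict.assoc _ _ _, Strict.assoc _ _ _, ?_⟩
  simp [Strict.associator_eqToIso]

theorem assoc_right {h k : a ⟶ b} (η : h ⟶ k) (f : b ⟶ c) (g : c ⟶ d) :
    η ▷ (f ≫ g) ≗ η ▷ f ▷ g := by
  refine ⟨(Strict.assoc _ _ _).symm, (Strict.assoc _ _ _).symm, ?_⟩
  simp [Strict.associator_eqToIso]

theorem assoc_mid (f : a ⟶ b) {h k : b ⟶ c} (η : h ⟶ k) (g : c ⟶ d) :
    (f ◁ η) ▷ g ≗ f ◁ η ▷ g := by
  refine ⟨Strict.assoc _ _ _, Strict.assoc _ _ _, ?_⟩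
  simp [Strict.associator_eqToIso]

theorem id_left {f g : a ⟶ b} (η : f ⟶ g) : 𝟙 a ◁ η ≗ η := by
  refine ⟨Strict.id_comp _, Strict.id_comp _, ?_⟩
  simp [Strict.leftUnitor_eqToIso]

theorem id_right {f g : a ⟶ b} (η : f ⟶ g) : η ▷ 𝟙 b ≗ η := by
  refine ⟨Strict.comp_id _, Strict.comp_id _, ?_⟩
  simp [Strict.rightUnitor_eqToIso]

theorem map₂_left {L : Type*} [Bicategory L] (T : StrictPseudofunctor K L)
    (f : a ⟶ b) {g h : b ⟶ c} (η : g ⟶ h) : T.map₂ (f ◁ η) ≗ T.map f ◁ T.map₂ η := by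
  refine ⟨T.map_comp _ _, T.map_comp _ _, ?_⟩
  simp [T.mapComp_eq_eqToIso]

theorem map₂_right {L : Type*} [Bicategory L] (T : StrictPseudofunctor K L)
    {g h : a ⟶ b} (η : g ⟶ h) (f : b ⟶ c) : T.map₂ (η ▷ f) ≗ T.map₂ η ▷ T.map f := by
  refine ⟨T.map_comp _ _, T.map_comp _ _, ?_⟩
  simp [T.mapComp_eq_eqToIso]

end TwoCellEq

end Strictness

/-! ### Enhanced 2-categories -/

/-- An enhanced 2-category: a strict 2-category (whose 1-cells are the *loose* ones) together with
a wide and locally full sub-2-category, given by the class of *tight* 1-cells. -/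
class Enhanced (K : Type u) [Bicategory.{w, v} K] extends Bicategory.Strict K where
  IsTight : ∀ {a b : K}, (a ⟶ b) → Prop
  id_tight : ∀ a : K, IsTight (𝟙 a)
  comp_tight : ∀ {a b c : K} {f : a ⟶ b} {g : b ⟶ c}, IsTight f → IsTight g → IsTight (f ≫ g)

open Enhanced

section Limits

variable {K : Type u} [Bicategory.{w, v} K]

/-- `fst` and `snd` exhibit `P` as a (strict) 2-pullback of `f` and `g`. -/
structure IsTwoPullback {P A B C : K} (fst : P ⟶ A) (snd : P ⟶ B) (f : A ⟶ C) (g : B ⟶ C) :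
    Prop where
  w : fst ≫ f = snd ≫ g
  existsUnique_lift : ∀ {X : K} (x : X ⟶ A) (y : X ⟶ B), x ≫ f = y ≫ g →
    ∃! h : X ⟶ P, h ≫ fst = x ∧ h ≫ snd = y
  existsUnique_lift₂ : ∀ {X : K} (h k : X ⟶ P) (φ : h ≫ fst ⟶ k ≫ fst) (ψ : h ≫ snd ⟶ k ≫ snd),
    φ ▷ f ≗ ψ ▷ g → ∃! γ : h ⟶ k, γ ▷ fst = φ ∧ γ ▷ snd = ψ

/-- A map `p : E ⟶ B` is a discrete opfibration when every 2-cell `φ : e ≫ p ⟶ b` is the image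
of a unique 2-cell `e ⟶ e'` with source `e`. -/
def IsDiscreteOpfibration {E B : K} (p : E ⟶ B) : Prop :=
  ∀ {X : K} (e : X ⟶ E) (b : X ⟶ B) (φ : e ≫ p ⟶ b),
    ∃! l : Σ e' : X ⟶ E, (e ⟶ e'), l.2 ▷ p ≗ φ

variable [Enhanced K]

/-- A 2-terminal object such that all maps into it are tight. -/
def IsTightTerminal (t : K) : Prop :=
  ∀ X : K, ∃ f : X ⟶ t, IsTight f ∧ (∀ g : X ⟶ t, g = f) ∧ ∀ η : f ⟶ f, η = 𝟙 f

/-- A left-tight pullback: a 2-pullback of a tight map `g` along a loose map `f` whose projection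
`fst` is tight and detects tightness. -/
structure IsLeftTightPullback {P A B C : K} (fst : P ⟶ A) (snd : P ⟶ B) (f : A ⟶ C) (g : B ⟶ C) :
    Prop extends IsTwoPullback fst snd f g where
  right_tight : IsTight g
  left_tight : IsTight fst
  detects : ∀ {X : K} (h : X ⟶ P), IsTight (h ≫ fst) → IsTight h

/-- A tight discrete opfibration. -/
structure IsTightDopf {E B : K} (p : E ⟶ B) : Prop where
  tight : IsTight p
  dopf : IsDiscreteOpfibration p

end Limits

/-- A plumbus: an enhanced 2-category with a tight terminal object and all left-tight pullbacks of
tight discrete opfibrations, in which tight discrete opfibrations detect tightness (that is, the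
pullback of a tight discrete opfibration along an identity, given by the identity square, is
left-tight). -/
structure IsPlumbus (K : Type u) [Bicategory.{w, v} K] [Enhanced K] : Prop where
  exists_terminal : ∃ t : K, IsTightTerminal t
  exists_pullback : ∀ {A E B : K} (f : A ⟶ B) (p : E ⟶ B), IsTightDopf p →
    ∃ (P : K) (fst : P ⟶ A) (snd : P ⟶ E), IsLeftTightPullback fst snd f p
  detects_tight : ∀ {X E B : K} (e : X ⟶ E) (p : E ⟶ B), IsTightDopf p →
    IsTight (e ≫ p) → IsTight e

section Classifier

variable {K : Type u} [Bicategory.{w, v} K] [Strict K]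

theorem IsTwoPullback.hom_ext {P A B C : K} {fst : P ⟶ A} {snd : P ⟶ B} {f : A ⟶ C} {g : B ⟶ C}
    (H : IsTwoPullback fst snd f g) {X : K} {h k : X ⟶ P} (h₁ : h ≫ fst = k ≫ fst)
    (h₂ : h ≫ snd = k ≫ snd) : h = k :=
  (H.existsUnique_lift (k ≫ fst) (k ≫ snd)
    (by rw [Strict.assoc, Strict.assoc, H.w])).unique ⟨h₁, h₂⟩ ⟨rfl, rfl⟩

theorem IsTwoPullback.dopf {P A B C : K} {fst : P ⟶ A} {snd : P ⟶ B} {f : A ⟶ C} {g : B ⟶ C}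
    (H : IsTwoPullback fst snd f g) (hg : IsDiscreteOpfibration g) :
    IsDiscreteOpfibration fst := by
  intro X e b φ
  have hw : (e ≫ snd) ≫ g = (e ≫ fst) ≫ f := by rw [Strict.assoc, Strict.assoc, H.w]
  obtain ⟨⟨y, l⟩, hl, hu⟩ := hg (e ≫ snd) (b ≫ f) (eqToHom hw ≫ φ ▷ f)
  have hl' : l ▷ g ≗ φ ▷ f := hl.trans (TwoCellEq.eqToHom_left _ _)
  obtain ⟨k, ⟨hk₁, hk₂⟩, -⟩ := H.existsUnique_lift b y hl'.choose_spec.choose.symm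
  subst hk₁ hk₂
  obtain ⟨γ, ⟨hγ₁, hγ₂⟩, hγ⟩ := H.existsUnique_lift₂ e k φ l hl'.symm
  refine ⟨⟨k, γ⟩, TwoCellEq.of_eq hγ₁, ?_⟩
  rintro ⟨k', γ'⟩ (hk' : γ' ▷ fst ≗ φ)
  have hkf : k' ≫ fst = k ≫ fst := hk'.choose_spec.choose
  have e₁ := hu ⟨k' ≫ snd, γ' ▷ snd⟩ (by
    refine TwoCellEq.trans ?_ (TwoCellEq.eqToHom_left _ _).symm
    refine (TwoCellEq.assoc_right _ _ _).symm.trans ?_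
    refine (TwoCellEq.whiskerRight H.w.symm (TwoCellEq.refl γ')).trans ?_
    exact (TwoCellEq.assoc_right _ _ _).trans (TwoCellEq.whiskerRight rfl hk'))
  have hks : k' ≫ snd = k ≫ snd := congrArg Sigma.fst e₁
  obtain rfl := H.hom_ext hkf hks
  have e₂ : γ' ▷ snd = l := by simpa using e₁
  rw [hγ γ' ⟨hk'.eq, e₂⟩]

theorem IsDiscreteOpfibration.unique {E B : K} {p : E ⟶ B} (hp : IsDiscreteOpfibration p) {X : K}
    {e e₁ e₂ : X ⟶ E} (l₁ : e ⟶ e₁) (l₂ : e ⟶ e₂) (h : l₁ ▷ p ≗ l₂ ▷ p) : l₁ ≗ l₂ := by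
  have := (hp e (e₂ ≫ p) (l₂ ▷ p)).unique (y₁ := ⟨e₁, l₁⟩) (y₂ := ⟨e₂, l₂⟩) h (TwoCellEq.refl _)
  cases this
  exact TwoCellEq.refl _

/-- Let `p` and `q` be maps into `B` with maps `x`, `y` into `E`, such that `(p, x)` and `(q, y)`
are pullback squares of a discrete opfibration `u : E ⟶ C` along `f` and along `g`. A 2-cell
`φ : f ⟶ g` *classifies* the map `h : p ⟶ q` over `B` when the lift along `u` of `p ◁ φ` with
source `x` has target `h ≫ y`. -/
structure Classifies {E C B P Q : K} (u : E ⟶ C) (p : P ⟶ B) (x : P ⟶ E) (q : Q ⟶ B)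
    (y : Q ⟶ E) {f g : B ⟶ C} (φ : f ⟶ g) (h : P ⟶ Q) : Prop where
  w : h ≫ q = p
  exists_lift : ∃ l : x ⟶ h ≫ y, l ▷ u ≗ p ◁ φ

theorem Classifies.existsUnique {E C B P Q : K} {u : E ⟶ C} {p : P ⟶ B} {x : P ⟶ E} {q : Q ⟶ B}
    {y : Q ⟶ E} {f g : B ⟶ C} (φ : f ⟶ g) (hu : IsDiscreteOpfibration u) (hp : p ≫ f = x ≫ u)
    (hq : IsTwoPullback q y g u) : ∃! h : P ⟶ Q, Classifies u p x q y φ h := by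
  obtain ⟨⟨z, l⟩, hl, hl'⟩ := hu x (p ≫ g) (eqToHom hp.symm ≫ p ◁ φ)
  replace hl : l ▷ u ≗ p ◁ φ := hl.trans (TwoCellEq.eqToHom_left _ _)
  obtain ⟨h, ⟨h₁, h₂⟩, h₃⟩ := hq.existsUnique_lift p z hl.choose_spec.choose.symm
  subst h₂
  refine ⟨h, ⟨h₁, l, hl⟩, ?_⟩
  rintro k ⟨k₁, l', k₂⟩
  have := congrArg Sigma.fst (hl' ⟨k ≫ y, l'⟩ (k₂.trans (TwoCellEq.eqToHom_left _ _).symm))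
  exact h₃ k ⟨k₁, this⟩

theorem Classifies.id {E C B P : K} {u : E ⟶ C} {p : P ⟶ B} {x : P ⟶ E} {f : B ⟶ C}
    (hp : p ≫ f = x ≫ u) : Classifies u p x p x (𝟙 f) (𝟙 P) :=
  ⟨Strict.id_comp _, eqToHom (Strict.id_comp x).symm, by
    refine (TwoCellEq.whiskerRight rfl (TwoCellEq.eqToHom_id _)).trans ?_
    refine ⟨hp.symm, hp.symm, by simp⟩⟩

theorem Classifies.comp {E C B P Q R : K} {u : E ⟶ C} {p : P ⟶ B} {x : P ⟶ E} {q : Q ⟶ B}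
    {y : Q ⟶ E} {r : R ⟶ B} {z : R ⟶ E} {f g k : B ⟶ C} {φ : f ⟶ g} {ψ : g ⟶ k} {s : P ⟶ Q}
    {t : Q ⟶ R} (hs : Classifies u p x q y φ s) (ht : Classifies u q y r z ψ t) :
    Classifies u p x r z (φ ≫ ψ) (s ≫ t) := by
  obtain ⟨rfl, l, hl⟩ := hs
  obtain ⟨rfl, m, hm⟩ := ht
  refine ⟨Strict.assoc s t r, l ≫ s ◁ m ≫ eqToHom (Strict.assoc s t z).symm, ?_⟩
  rw [← Category.assoc l, Bicategory.whiskerLeft_comp]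
  refine (TwoCellEq.whiskerRight rfl
    (TwoCellEq.eqToHom_right (Strict.assoc s t z).symm (l ≫ s ◁ m))).trans ?_
  rw [Bicategory.comp_whiskerRight]
  refine TwoCellEq.comp' hl ?_
  refine (TwoCellEq.assoc_mid s m u).trans ?_
  exact (TwoCellEq.whiskerLeft rfl hm).trans (TwoCellEq.assoc_left _ _ _).symm

end Classifier

section Classifier

variable {K : Type u} [Bicategory.{w, v} K] [Enhanced K]

theorem IsLeftTightPullback.tightDopf {P A B C : K} {fst : P ⟶ A} {snd : P ⟶ B} {f : A ⟶ C}
    {g : B ⟶ C} (H : IsLeftTightPullback fst snd f g) (hg : IsTightDopf g) : IsTightDopf fst :=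
  ⟨H.left_tight, H.dopf hg.dopf⟩

/-- A pullback-ideal of tight discrete opfibrations: a class of tight discrete opfibrations which
is replete (closed under isomorphism over the base) and stable under left-tight pullback. -/
structure IsPullbackIdeal (Small : ∀ {E B : K}, (E ⟶ B) → Prop) : Prop where
  tightDopf : ∀ {E B : K} (p : E ⟶ B), Small p → IsTightDopf p
  replete : ∀ {E E' B : K} (p : E ⟶ B) (p' : E' ⟶ B), Small p → IsTightDopf p' →
    ∀ (h : E ⟶ E') (k : E' ⟶ E), h ≫ k = 𝟙 E → k ≫ h = 𝟙 E' → h ≫ p' = p → Small p'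
  pullback : ∀ {P A E B : K} (fst : P ⟶ A) (snd : P ⟶ E) (f : A ⟶ B) (p : E ⟶ B), Small p →
    IsLeftTightPullback fst snd f p → Small fst

/-- The tight discrete opfibrations over `B`. -/
structure TdOpfib (B : K) where
  dom : K
  hom : dom ⟶ B
  isTightDopf : IsTightDopf hom

/-- Maps over `B`: `TdOpfib B` is a full subcategory of the slice over `B`. -/
@[ext]
structure TdOpfib.Hom {B : K} (p q : TdOpfib B) where
  map : p.dom ⟶ q.dom
  w : map ≫ q.hom = p.hom

instance (B : K) : Category (TdOpfib B) where
  Hom := TdOpfib.Hom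
  id p := ⟨𝟙 _, Strict.id_comp _⟩
  comp h k := ⟨h.map ≫ k.map, by rw [Strict.assoc, k.w, h.w]⟩
  id_comp h := TdOpfib.Hom.ext (Strict.id_comp _)
  comp_id h := TdOpfib.Hom.ext (Strict.comp_id _)
  assoc h k l := TdOpfib.Hom.ext (Strict.assoc _ _ _)

namespace TdOpfib

/-- The pullback `f^* u`. -/
noncomputable def pullback (hK : IsPlumbus K) {E C B : K} (u : E ⟶ C) (hu : IsTightDopf u)
    (f : B ⟶ C) : TdOpfib B where
  dom := (hK.exists_pullback f u hu).choose
  hom := (hK.exists_pullback f u hu).choose_spec.choose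
  isTightDopf := (hK.exists_pullback f u hu).choose_spec.choose_spec.choose_spec.tightDopf hu

/-- The second projection of the pullback `f^* u`. -/
noncomputable def pullbackSnd (hK : IsPlumbus K) {E C B : K} (u : E ⟶ C) (hu : IsTightDopf u)
    (f : B ⟶ C) : (pullback hK u hu f).dom ⟶ E :=
  (hK.exists_pullback f u hu).choose_spec.choose_spec.choose

theorem isLeftTightPullback (hK : IsPlumbus K) {E C B : K} (u : E ⟶ C) (hu : IsTightDopf u)
    (f : B ⟶ C) :
    IsLeftTightPullback (pullback hK u hu f).hom (pullbackSnd hK u hu f) f u :=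
  (hK.exists_pullback f u hu).choose_spec.choose_spec.choose_spec

theorem existsUnique_pullbackMap (hK : IsPlumbus K) {E C B : K} (u : E ⟶ C) (hu : IsTightDopf u)
    {f g : B ⟶ C} (φ : f ⟶ g) :
    ∃! h, Classifies u (pullback hK u hu f).hom (pullbackSnd hK u hu f)
      (pullback hK u hu g).hom (pullbackSnd hK u hu g) φ h :=
  Classifies.existsUnique φ hu.dopf (isLeftTightPullback hK u hu f).w
    (isLeftTightPullback hK u hu g).toIsTwoPullback

/-- The functor `f ↦ f^* u` from maps `B ⟶ C` to tight discrete opfibrations over `B`; a 2-cell is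
sent to the map over `B` which it classifies. (It depends on the choice of pullbacks only up to a
canonical isomorphism, by which it is also pseudonatural in `B`.) -/
noncomputable def pullbackFunctor (hK : IsPlumbus K) {E C : K} (u : E ⟶ C) (hu : IsTightDopf u)
    (B : K) : (B ⟶ C) ⥤ TdOpfib B where
  obj f := pullback hK u hu f
  map φ := ⟨(existsUnique_pullbackMap hK u hu φ).choose,
    (existsUnique_pullbackMap hK u hu φ).choose_spec.1.w⟩
  map_id f := TdOpfib.Hom.ext
    ((existsUnique_pullbackMap hK u hu (𝟙 f)).unique
      (existsUnique_pullbackMap hK u hu (𝟙 f)).choose_spec.1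
      (Classifies.id (isLeftTightPullback hK u hu f).w))
  map_comp φ ψ := TdOpfib.Hom.ext
    ((existsUnique_pullbackMap hK u hu (φ ≫ ψ)).unique
      (existsUnique_pullbackMap hK u hu (φ ≫ ψ)).choose_spec.1
      (Classifies.comp (existsUnique_pullbackMap hK u hu φ).choose_spec.1
        (existsUnique_pullbackMap hK u hu ψ).choose_spec.1))

end TdOpfib

/-- `u` is a 2-classifier for the class `Small` of tight discrete opfibrations: `u` is small, and
for every `B` pulling back `u` is a fully faithful functor from `K(B, Ω)` to tight discrete
opfibrations over `B`, with essential image the small ones (so that it corestricts to an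
equivalence onto the full subcategory of small discrete opfibrations over `B`). -/
structure IsTwoClassifier (hK : IsPlumbus K) (Small : ∀ {E B : K}, (E ⟶ B) → Prop)
    {Ωpt Ω : K} (u : Ωpt ⟶ Ω) : Prop where
  small : Small u
  tightDopf : IsTightDopf u
  full : ∀ B : K, (TdOpfib.pullbackFunctor hK u tightDopf B).Full
  faithful : ∀ B : K, (TdOpfib.pullbackFunctor hK u tightDopf B).Faithful
  essImage_iff : ∀ {B : K} (p : TdOpfib B),
    (TdOpfib.pullbackFunctor hK u tightDopf B).essImage p ↔ Small p.hom

/-- A representable plumbus: a plumbus with a pullback-ideal `Small` of tight discrete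
opfibrations containing the identity of the terminal object, and a 2-classifier `u` for it. -/
structure IsRepresentablePlumbus (Small : ∀ {E B : K}, (E ⟶ B) → Prop) {Ωpt Ω : K}
    (u : Ωpt ⟶ Ω) : Prop where
  isPlumbus : IsPlumbus K
  isPullbackIdeal : IsPullbackIdeal Small
  small_id : ∀ t : K, IsTightTerminal t → Small (𝟙 t)
  isTwoClassifier : IsTwoClassifier isPlumbus Small u

end Classifier

/-! ### Enhanced 2-monads and their algebras -/

open Enhanced

/-- An enhanced 2-monad: a 2-functor `T` preserving tightness, with 2-natural unit `i` and
multiplication `m` having tight components and satisfying the strict monad laws. -/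
structure EnhancedTwoMonad (K : Type u) [Bicategory.{w, v} K] [Enhanced K] where
  T : StrictPseudofunctor K K
  map_tight : ∀ {A B : K} (f : A ⟶ B), IsTight f → IsTight (T.map f)
  i : ∀ A : K, A ⟶ T.obj A
  i_tight : ∀ A : K, IsTight (i A)
  i_naturality : ∀ {A B : K} (f : A ⟶ B), f ≫ i B = i A ≫ T.map f
  i_naturality₂ : ∀ {A B : K} {f g : A ⟶ B} (η : f ⟶ g), η ▷ i B ≗ i A ◁ T.map₂ η
  m : ∀ A : K, T.obj (T.obj A) ⟶ T.obj A
  m_tight : ∀ A : K, IsTight (m A)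
  m_naturality : ∀ {A B : K} (f : A ⟶ B), T.map (T.map f) ≫ m B = m A ≫ T.map f
  m_naturality₂ : ∀ {A B : K} {f g : A ⟶ B} (η : f ⟶ g),
    T.map₂ (T.map₂ η) ▷ m B ≗ m A ◁ T.map₂ η
  i_m : ∀ A : K, i (T.obj A) ≫ m A = 𝟙 (T.obj A)
  map_i_m : ∀ A : K, T.map (i A) ≫ m A = 𝟙 (T.obj A)
  assoc : ∀ A : K, T.map (m A) ≫ m A = m (T.obj A) ≫ m A

section Algebras

variable {K : Type u} [Bicategory.{w, v} K] [Enhanced K]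

/-- A strict `T`-algebra with tight structure map. -/
structure Alg (M : EnhancedTwoMonad K) where
  carrier : K
  str : M.T.obj carrier ⟶ carrier
  str_tight : IsTight str
  unit : M.i carrier ≫ str = 𝟙 carrier
  assoc : M.m carrier ≫ str = M.T.map str ≫ str

namespace Alg

variable {M : EnhancedTwoMonad K}

theorem lax_source_eq (A B : Alg M) (f : A.carrier ⟶ B.carrier) :
    M.T.map (A.str ≫ f) ≫ B.str = M.T.map A.str ≫ M.T.map f ≫ B.str := by
  rw [M.T.map_comp, Strict.assoc]

/-- A lax `T`-morphism: a map `hom` with a laxator satisfying the unit and multiplication laws. -/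
structure LaxHom (A B : Alg M) where
  hom : A.carrier ⟶ B.carrier
  laxator : M.T.map hom ≫ B.str ⟶ A.str ≫ hom
  unit : M.i A.carrier ◁ laxator ≗ 𝟙 hom
  mul : M.m A.carrier ◁ laxator ≗
    M.T.map₂ laxator ▷ B.str ≫ eqToHom (lax_source_eq A B hom) ≫ M.T.map A.str ◁ laxator

/-- A `T`-2-morphism: a 2-cell compatible with the laxators. -/
@[ext]
structure LaxHom₂ {A B : Alg M} (f g : LaxHom A B) where
  hom₂ : f.hom ⟶ g.hom
  w : M.T.map₂ hom₂ ▷ B.str ≫ g.laxator = f.laxator ≫ A.str ◁ hom₂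

theorem LaxHom.ext {A B : Alg M} {f g : LaxHom A B} (h : f.hom = g.hom)
    (h' : f.laxator ≗ g.laxator) : f = g := by
  obtain ⟨f, φ, _, _⟩ := f
  obtain ⟨g, ψ, _, _⟩ := g
  obtain rfl : f = g := h
  obtain rfl : φ = ψ := h'.eq
  rfl

instance (A B : Alg M) : Category (LaxHom A B) where
  Hom := LaxHom₂
  id f := ⟨𝟙 f.hom, by simp⟩
  comp φ ψ := ⟨φ.hom₂ ≫ ψ.hom₂, by
    rw [PrelaxFunctor.map₂_comp, Bicategory.comp_whiskerRight, Category.assoc, ψ.w,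
      ← Category.assoc, φ.w, Category.assoc, Bicategory.whiskerLeft_comp]⟩
  id_comp φ := LaxHom₂.ext (Category.id_comp _)
  comp_id φ := LaxHom₂.ext (Category.comp_id _)
  assoc φ ψ χ := LaxHom₂.ext (Category.assoc _ _ _)

/-- A map commuting strictly with the algebra structures, as a lax morphism whose laxator is an
identity. -/
def LaxHom.ofStrict {A B : Alg M} (f : A.carrier ⟶ B.carrier)
    (hf : M.T.map f ≫ B.str = A.str ≫ f) : LaxHom A B where
  hom := f
  laxator := eqToHom hf
  unit := by
    refine (TwoCellEq.whiskerLeft rfl (TwoCellEq.eqToHom_id hf)).trans ?_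
    have : M.i A.carrier ≫ M.T.map f ≫ B.str = f := by
      rw [hf, ← Strict.assoc, A.unit, Strict.id_comp]
    exact ⟨this, this, by simp⟩
  mul := by
    have h₁ := TwoCellEq.whiskerLeft (rfl : M.m A.carrier = _) (TwoCellEq.eqToHom_id hf)
    refine h₁.trans (TwoCellEq.symm ?_)
    have h₂ : M.T.map₂ (eqToHom hf) ▷ B.str = eqToHom (by rw [hf]) := by
      rw [PrelaxFunctor.map₂_eqToHom, Bicategory.eqToHom_whiskerRight]
    rw [h₂, Bicategory.whiskerLeft_eqToHom, eqToHom_trans, eqToHom_trans]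
    have : M.T.map (M.T.map f ≫ B.str) ≫ B.str = M.m A.carrier ≫ M.T.map f ≫ B.str := by
      rw [M.T.map_comp, Strict.assoc, ← B.assoc, ← Strict.assoc, M.m_naturality, Strict.assoc]
    refine (TwoCellEq.eqToHom_id _).trans ⟨this, this, by simp⟩

/-- The laxator of a composite, pasted from those of `f` and `g`. -/
def LaxHom.compLaxator {A B C : Alg M} (f : LaxHom A B) (g : LaxHom B C) :
    M.T.map (f.hom ≫ g.hom) ≫ C.str ⟶ A.str ≫ f.hom ≫ g.hom :=
  eqToHom (by rw [M.T.map_comp, Strict.assoc]) ≫ (M.T.map f.hom ◁ g.laxator) ≫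
    eqToHom (Strict.assoc _ _ _).symm ≫ (f.laxator ▷ g.hom) ≫ eqToHom (Strict.assoc _ _ _)

theorem LaxHom.compLaxator_eq {A B C : Alg M} (f : LaxHom A B) (g : LaxHom B C) :
    f.compLaxator g ≗ (M.T.map f.hom ◁ g.laxator) ≫ eqToHom (Strict.assoc _ _ _).symm ≫
      (f.laxator ▷ g.hom) := by
  refine (TwoCellEq.eqToHom_left _ _).trans ?_
  simpa using TwoCellEq.eqToHom_right (Strict.assoc A.str f.hom g.hom)
    ((M.T.map f.hom ◁ g.laxator) ≫ eqToHom (Strict.assoc _ _ _).symm ≫ (f.laxator ▷ g.hom))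


theorem LaxHom.comp_unit {A B C : Alg M} (f : LaxHom A B) (g : LaxHom B C) :
    M.i A.carrier ◁ f.compLaxator g ≗ 𝟙 (f.hom ≫ g.hom) := by
  refine (TwoCellEq.whiskerLeft rfl (f.compLaxator_eq g)).trans ?_
  rw [Bicategory.whiskerLeft_comp, Bicategory.whiskerLeft_comp, Bicategory.whiskerLeft_eqToHom]
  have h₁ : M.i A.carrier ◁ M.T.map f.hom ◁ g.laxator ≗ 𝟙 (f.hom ≫ g.hom) := by
    refine (TwoCellEq.assoc_left _ _ _).symm.trans ?_
    refine (TwoCellEq.whiskerLeft (M.i_naturality f.hom).symm (TwoCellEq.refl _)).trans ?_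
    refine (TwoCellEq.assoc_left _ _ _).trans ?_
    exact (TwoCellEq.whiskerLeft rfl g.unit).trans (TwoCellEq.of_eq (by simp))
  have h₂ : M.i A.carrier ◁ f.laxator ▷ g.hom ≗ 𝟙 (f.hom ≫ g.hom) := by
    refine (TwoCellEq.assoc_mid _ _ _).symm.trans ?_
    exact (TwoCellEq.whiskerRight rfl f.unit).trans (TwoCellEq.of_eq (by simp))
  exact (TwoCellEq.comp _ rfl h₁ h₂).trans (TwoCellEq.of_eq (by simp))

theorem LaxHom.comp_mul {A B C : Alg M} (f : LaxHom A B) (g : LaxHom B C) :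
    M.m A.carrier ◁ f.compLaxator g ≗ M.T.map₂ (f.compLaxator g) ▷ C.str ≫
      eqToHom (lax_source_eq A C (f.hom ≫ g.hom)) ≫ M.T.map A.str ◁ f.compLaxator g := by
  have hg := (TwoCellEq.assoc_left (M.m A.carrier) (M.T.map f.hom) g.laxator).symm.trans <|
    (TwoCellEq.whiskerLeft (M.m_naturality f.hom).symm (TwoCellEq.refl _)).trans <|
    (TwoCellEq.assoc_left _ _ _).trans <|
    (TwoCellEq.whiskerLeft rfl g.mul).trans <|
    (TwoCellEq.whiskerLeft_mid _ _ _ _).trans <|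
    TwoCellEq.compMid (TwoCellEq.refl _)
      ((TwoCellEq.assoc_left _ _ _).symm.trans
        (TwoCellEq.whiskerLeft (M.T.map_comp (M.T.map f.hom) B.str).symm (TwoCellEq.refl _)))
  have hf := (TwoCellEq.assoc_mid (M.m A.carrier) f.laxator g.hom).symm.trans <|
    (TwoCellEq.whiskerRight rfl f.mul).trans <|
    (TwoCellEq.whiskerRight_mid _ _ _ _).trans <|
    TwoCellEq.compMid (TwoCellEq.assoc_right _ _ _).symm (TwoCellEq.assoc_mid _ _ _)
  have hL := (TwoCellEq.whiskerLeft (rfl : M.m A.carrier = _) (f.compLaxator_eq g)).trans <|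
    (TwoCellEq.whiskerLeft_mid _ _ _ _).trans (TwoCellEq.compMid hg hf)
  have hT := (TwoCellEq.whiskerRight (rfl : C.str = _)
    ((TwoCellEq.map₂ M.T (f.compLaxator_eq g)).trans <|
      (TwoCellEq.map₂_mid M.T _ _ _).trans <|
        TwoCellEq.compMid (TwoCellEq.map₂_left M.T _ _) (TwoCellEq.map₂_right M.T _ _))).trans <|
    (TwoCellEq.whiskerRight_mid _ _ _ _).trans <|
    TwoCellEq.compMid (TwoCellEq.assoc_mid _ _ _) (TwoCellEq.assoc_right _ _ _).symm
  have hA := (TwoCellEq.whiskerLeft (rfl : M.T.map A.str = _) (f.compLaxator_eq g)).trans <|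
    (TwoCellEq.whiskerLeft_mid _ _ _ _).trans <|
    TwoCellEq.compMid
      ((TwoCellEq.assoc_left _ _ _).symm.trans
        (TwoCellEq.whiskerLeft (M.T.map_comp A.str f.hom).symm (TwoCellEq.refl _)))
      (TwoCellEq.refl _)
  have hR := TwoCellEq.compMid (e := lax_source_eq A C (f.hom ≫ g.hom)) hT hA
  refine hL.trans (TwoCellEq.trans ?_ hR.symm)
  simp only [Category.assoc]
  refine TwoCellEq.compMid (TwoCellEq.refl _) ?_
  have hx := TwoCellEq.exchange (M.T.map₂ f.laxator) g.laxator
  have := TwoCellEq.compMid (e := by rw [← Strict.assoc, lax_source_eq, Strict.assoc, Strict.assoc])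
    hx (TwoCellEq.refl (M.T.map A.str ◁ f.laxator ▷ g.hom))
  simp only [Category.assoc] at this
  exact this

/-- The identity lax morphism. -/
def LaxHom.id (A : Alg M) : LaxHom A A :=
  LaxHom.ofStrict (𝟙 A.carrier) (by rw [M.T.map_id, Strict.id_comp, Strict.comp_id])

/-- The composite of lax morphisms. -/
def LaxHom.comp {A B C : Alg M} (f : LaxHom A B) (g : LaxHom B C) : LaxHom A C where
  hom := f.hom ≫ g.hom
  laxator := f.compLaxator g
  unit := f.comp_unit g
  mul := f.comp_mul g

theorem LaxHom.id_laxator (A : Alg M) : (LaxHom.id A).laxator ≗ 𝟙 A.str := by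
  have e : M.T.map (𝟙 A.carrier) ≫ A.str = A.str := by rw [M.T.map_id, Strict.id_comp]
  exact ⟨e, Strict.comp_id _, by simp [LaxHom.id, LaxHom.ofStrict]⟩

theorem LaxHom.id_comp {A B : Alg M} (f : LaxHom A B) : (LaxHom.id A).comp f = f := by
  refine LaxHom.ext (Strict.id_comp _) ?_
  refine (LaxHom.compLaxator_eq _ _).trans ?_
  have h₁ := (TwoCellEq.whiskerLeft (M.T.map_id A.carrier) (TwoCellEq.refl f.laxator)).trans
    (TwoCellEq.id_left _)
  have h₂ := (TwoCellEq.whiskerRight (rfl : f.hom = _) (LaxHom.id_laxator A)).trans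
    (TwoCellEq.of_eq (Bicategory.id_whiskerRight _ _))
  exact (TwoCellEq.compMid h₁ h₂).trans (TwoCellEq.of_eq (by simp))

theorem LaxHom.comp_id {A B : Alg M} (f : LaxHom A B) : f.comp (LaxHom.id B) = f := by
  refine LaxHom.ext (Strict.comp_id _) ?_
  refine (LaxHom.compLaxator_eq _ _).trans ?_
  have h₁ := (TwoCellEq.whiskerLeft (rfl : M.T.map f.hom = _) (LaxHom.id_laxator B)).trans
    (TwoCellEq.of_eq (Bicategory.whiskerLeft_id _ _))
  exact (TwoCellEq.compMid h₁ (TwoCellEq.id_right f.laxator)).trans (TwoCellEq.of_eq (by simp))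

theorem LaxHom.comp_assoc {A B C D : Alg M} (f : LaxHom A B) (g : LaxHom B C) (h : LaxHom C D) :
    (f.comp g).comp h = f.comp (g.comp h) := by
  refine LaxHom.ext (Strict.assoc _ _ _) ?_
  have h₁ := (LaxHom.compLaxator_eq (f.comp g) h).trans <|
    TwoCellEq.compMid
      ((TwoCellEq.whiskerLeft (M.T.map_comp f.hom g.hom) (TwoCellEq.refl h.laxator)).trans
        (TwoCellEq.assoc_left _ _ _))
      ((TwoCellEq.whiskerRight (rfl : h.hom = _) (LaxHom.compLaxator_eq f g)).trans <|
        (TwoCellEq.whiskerRight_mid _ _ _ _).trans <|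
        TwoCellEq.compMid (TwoCellEq.assoc_mid _ _ _) (TwoCellEq.assoc_right _ _ _).symm)
  have h₂ := (LaxHom.compLaxator_eq f (g.comp h)).trans <|
    TwoCellEq.compMid
      ((TwoCellEq.whiskerLeft (rfl : M.T.map f.hom = _) (LaxHom.compLaxator_eq g h)).trans
        (TwoCellEq.whiskerLeft_mid _ _ _ _))
      (TwoCellEq.refl _)
  refine h₁.trans (TwoCellEq.trans (TwoCellEq.of_eq ?_) h₂.symm)
  simp only [Category.assoc]
  rfl

theorem hom₂_w_of_eq {A B : Alg M} {f g : LaxHom A B} (h : f = g) {φ : f.hom ⟶ g.hom}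
    (hφ : φ = eqToHom (congrArg LaxHom.hom h)) :
    M.T.map₂ φ ▷ B.str ≫ g.laxator = f.laxator ≫ A.str ◁ φ := by
  subst h hφ
  simp

instance : CategoryStruct (Alg M) where
  Hom := LaxHom
  id := LaxHom.id
  comp := LaxHom.comp

/-- Left whiskering of a `T`-2-morphism. -/
def LaxHom₂.whiskerLeft {A B C : Alg M} (f : LaxHom A B) {g h : LaxHom B C} (η : LaxHom₂ g h) :
    LaxHom₂ (f.comp g) (f.comp h) where
  hom₂ := f.hom ◁ η.hom₂
  w := by
    apply TwoCellEq.eq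
    have hL := TwoCellEq.compMid' ((TwoCellEq.whiskerRight (rfl : C.str = _)
      (TwoCellEq.map₂_left M.T f.hom η.hom₂)).trans (TwoCellEq.assoc_mid _ _ _))
      (f.compLaxator_eq h)
    have hR := TwoCellEq.compMid' (f.compLaxator_eq g)
      (TwoCellEq.assoc_left A.str f.hom η.hom₂).symm
    refine hL.trans (TwoCellEq.trans ?_ hR.symm)
    have hx := TwoCellEq.compMid (e := (Strict.assoc _ _ _).symm)
      (TwoCellEq.refl (M.T.map f.hom ◁ g.laxator)) (TwoCellEq.exchange f.laxator η.hom₂)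
    have hy := TwoCellEq.compMid (e := (Strict.assoc _ _ _).symm)
      (TwoCellEq.of_eq (congrArg (M.T.map f.hom ◁ ·) η.w)) (TwoCellEq.refl (f.laxator ▷ h.hom))
    have hz := TwoCellEq.compMid (e := (Strict.assoc _ _ _).symm)
      (TwoCellEq.compMid' (TwoCellEq.refl (M.T.map f.hom ◁ g.laxator))
        (TwoCellEq.assoc_left (M.T.map f.hom) B.str η.hom₂).symm)
      (TwoCellEq.refl (f.laxator ▷ h.hom))
    simp only [Bicategory.whiskerLeft_comp, Category.assoc, eqToHom_refl, Category.id_comp]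
      at hx hy hz ⊢
    exact hy.trans (hz.trans hx)

/-- Right whiskering of a `T`-2-morphism. -/
def LaxHom₂.whiskerRight {A B C : Alg M} {f g : LaxHom A B} (η : LaxHom₂ f g) (h : LaxHom B C) :
    LaxHom₂ (f.comp h) (g.comp h) where
  hom₂ := η.hom₂ ▷ h.hom
  w := by
    apply TwoCellEq.eq
    have hL := TwoCellEq.compMid' ((TwoCellEq.whiskerRight (rfl : C.str = _)
      (TwoCellEq.map₂_right M.T η.hom₂ h.hom)).trans (TwoCellEq.assoc_right _ _ _).symm)
      (g.compLaxator_eq h)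
    have hR := TwoCellEq.compMid' (f.compLaxator_eq h)
      (TwoCellEq.assoc_mid A.str η.hom₂ h.hom).symm
    refine hL.trans (TwoCellEq.trans ?_ hR.symm)
    have hx := TwoCellEq.compMid (e := (Strict.assoc _ _ _).symm)
      (TwoCellEq.exchange (M.T.map₂ η.hom₂) h.laxator).symm (TwoCellEq.refl (g.laxator ▷ h.hom))
    have hy := TwoCellEq.compMid (e := rfl)
      (TwoCellEq.refl (M.T.map f.hom ◁ h.laxator))
      (TwoCellEq.compMid (e := (Strict.assoc _ _ _).symm)
        (TwoCellEq.assoc_right (M.T.map₂ η.hom₂) B.str h.hom)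
        (TwoCellEq.refl (g.laxator ▷ h.hom)))
    have hz := TwoCellEq.compMid (e := (Strict.assoc _ _ _).symm)
      (TwoCellEq.refl (M.T.map f.hom ◁ h.laxator))
      (TwoCellEq.of_eq (congrArg (· ▷ h.hom) η.w))
    simp only [Bicategory.comp_whiskerRight, Category.assoc, eqToHom_refl, Category.id_comp]
      at hx hy hz ⊢
    exact hx.trans (hy.trans hz)

/-- The associator, carried by that of `K`. -/
def LaxHom.associator {A B C D : Alg M} (f : LaxHom A B) (g : LaxHom B C) (h : LaxHom C D) :
    (f.comp g).comp h ≅ f.comp (g.comp h) where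
  hom := ⟨(α_ f.hom g.hom h.hom).hom,
    hom₂_w_of_eq (f.comp_assoc g h) (by rw [Strict.associator_eqToIso]; rfl)⟩
  inv := ⟨(α_ f.hom g.hom h.hom).inv,
    hom₂_w_of_eq (f.comp_assoc g h).symm (by rw [Strict.associator_eqToIso]; rfl)⟩
  hom_inv_id := LaxHom₂.ext (Iso.hom_inv_id _)
  inv_hom_id := LaxHom₂.ext (Iso.inv_hom_id _)

/-- The left unitor, carried by that of `K`. -/
def LaxHom.leftUnitor {A B : Alg M} (f : LaxHom A B) : (LaxHom.id A).comp f ≅ f where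
  hom := ⟨(λ_ f.hom).hom, hom₂_w_of_eq f.id_comp (by rw [Strict.leftUnitor_eqToIso]; rfl)⟩
  inv := ⟨(λ_ f.hom).inv, hom₂_w_of_eq f.id_comp.symm (by rw [Strict.leftUnitor_eqToIso]; rfl)⟩
  hom_inv_id := LaxHom₂.ext (Iso.hom_inv_id _)
  inv_hom_id := LaxHom₂.ext (Iso.inv_hom_id _)

/-- The right unitor, carried by that of `K`. -/
def LaxHom.rightUnitor {A B : Alg M} (f : LaxHom A B) : f.comp (LaxHom.id B) ≅ f where
  hom := ⟨(ρ_ f.hom).hom, hom₂_w_of_eq f.comp_id (by rw [Strict.rightUnitor_eqToIso]; rfl)⟩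
  inv := ⟨(ρ_ f.hom).inv, hom₂_w_of_eq f.comp_id.symm (by rw [Strict.rightUnitor_eqToIso]; rfl)⟩
  hom_inv_id := LaxHom₂.ext (Iso.hom_inv_id _)
  inv_hom_id := LaxHom₂.ext (Iso.inv_hom_id _)

/-- The bicategory of strict algebras, lax morphisms and `T`-2-morphisms: all operations on
2-cells are those of `K`. -/
instance : Bicategory (Alg M) where
  homCategory A B := inferInstanceAs (Category (LaxHom A B))
  whiskerLeft f _ _ η := LaxHom₂.whiskerLeft f η
  whiskerRight η h := LaxHom₂.whiskerRight η h
  associator := LaxHom.associator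
  leftUnitor := LaxHom.leftUnitor
  rightUnitor := LaxHom.rightUnitor
  whiskerLeft_id _ _ := LaxHom₂.ext (Bicategory.whiskerLeft_id _ _)
  whiskerLeft_comp _ _ _ _ _ _ := LaxHom₂.ext (Bicategory.whiskerLeft_comp _ _ _)
  id_whiskerLeft _ := LaxHom₂.ext (Bicategory.id_whiskerLeft _)
  comp_whiskerLeft _ _ _ _ _ := LaxHom₂.ext (Bicategory.comp_whiskerLeft _ _ _)
  id_whiskerRight _ _ := LaxHom₂.ext (Bicategory.id_whiskerRight _ _)
  comp_whiskerRight _ _ _ := LaxHom₂.ext (Bicategory.comp_whiskerRight _ _ _)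
  whiskerRight_id _ := LaxHom₂.ext (Bicategory.whiskerRight_id _)
  whiskerRight_comp _ _ _ := LaxHom₂.ext (Bicategory.whiskerRight_comp _ _ _)
  whisker_assoc _ _ _ _ _ := LaxHom₂.ext (Bicategory.whisker_assoc _ _ _)
  whisker_exchange _ _ := LaxHom₂.ext (Bicategory.whisker_exchange _ _)
  pentagon _ _ _ _ := LaxHom₂.ext (Bicategory.pentagon _ _ _ _)
  triangle _ _ := LaxHom₂.ext (Bicategory.triangle _ _)

theorem hom₂_eqToHom {A B : Alg M} {f g : LaxHom A B} (h : f = g) :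
    (eqToHom h : f ⟶ g).hom₂ = eqToHom (congrArg LaxHom.hom h) := by
  subst h; rfl

instance : Bicategory.Strict (Alg M) where
  id_comp := LaxHom.id_comp
  comp_id := LaxHom.comp_id
  assoc := LaxHom.comp_assoc
  leftUnitor_eqToIso f := Iso.ext (LaxHom₂.ext
    ((congrArg Iso.hom (Strict.leftUnitor_eqToIso (LaxHom.hom f))).trans
      (hom₂_eqToHom (LaxHom.id_comp f)).symm))
  rightUnitor_eqToIso f := Iso.ext (LaxHom₂.ext
    ((congrArg Iso.hom (Strict.rightUnitor_eqToIso (LaxHom.hom f))).trans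
      (hom₂_eqToHom (LaxHom.comp_id f)).symm))
  associator_eqToIso f g h := Iso.ext (LaxHom₂.ext
    ((congrArg Iso.hom (Strict.associator_eqToIso (LaxHom.hom f) (LaxHom.hom g)
      (LaxHom.hom h))).trans (hom₂_eqToHom (LaxHom.comp_assoc f g h)).symm))

/-- A lax morphism is strict when its laxator is an identity. -/
def LaxHom.IsStrict {A B : Alg M} (f : LaxHom A B) : Prop :=
  f.laxator ≗ 𝟙 (A.str ≫ f.hom)

theorem LaxHom.isStrict_comp {A B C : Alg M} {f : LaxHom A B} {g : LaxHom B C} (hf : f.IsStrict)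
    (hg : g.IsStrict) : (f.comp g).IsStrict := by
  refine (LaxHom.compLaxator_eq f g).trans ?_
  have h₁ := (TwoCellEq.whiskerLeft (rfl : M.T.map f.hom = _) hg).trans
    (TwoCellEq.of_eq (Bicategory.whiskerLeft_id _ _))
  have h₂ := (TwoCellEq.whiskerRight (rfl : g.hom = _) hf).trans
    (TwoCellEq.of_eq (Bicategory.id_whiskerRight _ _))
  refine (TwoCellEq.compMid h₁ h₂).trans ?_
  rw [Category.id_comp]
  exact (TwoCellEq.eqToHom_left _ _).trans
    ⟨Strict.assoc _ _ _, Strict.assoc _ _ _, by simp [LaxHom.comp]⟩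

/-- The enhanced 2-category `Alg_lx(T)`: a lax morphism is tight when it is strict and its
underlying map is tight. -/
instance : Enhanced (Alg M) where
  IsTight f := LaxHom.IsStrict f ∧ IsTight (LaxHom.hom f)
  id_tight A := ⟨(LaxHom.id_laxator A).trans (TwoCellEq.id_congr (Strict.comp_id _).symm),
    id_tight A.carrier⟩
  comp_tight hf hg := ⟨LaxHom.isStrict_comp hf.1 hg.1, comp_tight hf.2 hg.2⟩

/-- The class of tight discrete opfibrations of `Alg_lx(T)` whose underlying map is small. -/
def Small (S : ∀ {E B : K}, (E ⟶ B) → Prop) {E B : Alg M} (p : E ⟶ B) : Prop :=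
  IsTightDopf p ∧ S (LaxHom.hom p)

/-- Let `p : E ⟶ B` be a morphism of algebras and let `P`, with projections `fst` and `snd`, be a
pullback of the underlying map of `p` along the structure map of `B`. The map `δ` is the
`T`-cartesianity defect of `p`: the comparison map `TE ⟶ P` induced by `Tp` and by the structure
map of `E`. -/
structure IsCartesianityDefect {E B : Alg M} (p : LaxHom E B) {P : K}
    (fst : P ⟶ M.T.obj B.carrier) (snd : P ⟶ E.carrier) (δ : M.T.obj E.carrier ⟶ P) : Prop where
  isTwoPullback : IsTwoPullback fst snd B.str p.hom
  fst_eq : δ ≫ fst = M.T.map p.hom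
  snd_eq : δ ≫ snd = E.str

end Alg

end Algebras

end Plumbus

open Plumbus Plumbus.Enhanced

/-! A 2-classifier turns 2-cells into maps. If `(p, x)` is a pullback of `u` along `f`, a 2-cell `φ
: f ⟶ g` amounts to a map `z` with `z ≫ u = p ≫ g`: the end of the lift of `p ◁ φ` starting at `x`
(`IsRepresentablePlumbus.existsUnique_classifier`). Hence two parallel 2-cells into `Ω` agree once
their lifts end at the same map (`classifier_ext`).

Let `p : E ⟶ B` be a strict morphism, with structure maps `η` and `β`, whose underlying map is the
pullback of `u` along `d`. As `T` preserves pullbacks of `u`, and `Tu` is the pullback of `u` along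
`ω`, the pair `(Tp, Tx ≫ ωpt)` is a pullback of `u` along `Td ≫ ω` (`map_pullback`). Strictness of
`p` puts `η ≫ x` over `β ≫ d`, so exactly one 2-cell `Td ≫ ω ⟶ β ≫ d` has a lift ending there. This
is the laxator of `d`; its unit and multiplication laws reduce to those of `η`
(`Alg.exists_lax_square`). Conversely, a commuting square of lax morphisms whose sides `p` and `u`
are strict says precisely that the laxator of `x` lifts that of `d` (`Alg.laxator_lift`).
Uniqueness, full faithfulness and the description of the defect all follow from this.

The algebra laws of `ωpt` come from rigidity (`classifier_rigid`). The identity of `Ωpt` has a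
classifying map `c`, and there is a tautological 2-cell from `c` to `u`. By the exchange law it
forces the relevant lifts to be trivial.

The plumbus structure on algebras rests on unique lifting: laxators and their laws lift along strict
discrete opfibrations, and left-tight pullbacks are created in `K`. Free algebras give the converse,
that the underlying map of a strict discrete opfibration of algebras is a discrete opfibration. -/

namespace Plumbus

/-! ### Discrete opfibrations and 2-pullbacks in a strict 2-category. -/

section StrictTwoCategory

variable {K : Type u} [Bicategory.{w, v} K] [Strict K]

theorem TwoCellEq.sigma_eq {a b : K} {f g h : a ⟶ b} {η : f ⟶ g} {θ : f ⟶ h} (H : η ≗ θ) :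
    (⟨g, η⟩ : Σ k : a ⟶ b, (f ⟶ k)) = ⟨h, θ⟩ := by
  obtain ⟨_, rfl, rfl⟩ := H
  simp

theorem TwoCellEq.id_comp_mid {a b : K} {f f' g h : a ⟶ b} {η : f ⟶ f'} (H : η ≗ 𝟙 f) (e : f' = g)
    (θ : g ⟶ h) : η ≫ eqToHom e ≫ θ ≗ θ := by
  refine (compMid H (refl θ)).trans ?_
  rw [Category.id_comp]
  exact eqToHom_left _ _

theorem TwoCellEq.comp_id_mid {a b : K} {f g h k : a ⟶ b} {θ : h ⟶ k} (H : θ ≗ 𝟙 h) (e : g = h)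
    (η : f ⟶ g) : η ≫ eqToHom e ≫ θ ≗ η := by
  subst e
  obtain ⟨_, rfl, rfl⟩ := H
  exact of_eq (by simp)

/-- Rebases a 2-cell along equalities of its boundary when these cannot be substituted away. -/
theorem TwoCellEq.exists_congr {a b : K} {f g f' g' : a ⟶ b} (hf : f = f') (hg : g = g')
    (η : f ⟶ g) : ∃ θ : f' ⟶ g', θ ≗ η := by
  subst hf hg
  exact ⟨η, refl η⟩

theorem IsDiscreteOpfibration.exists_lift {E B : K} {p : E ⟶ B} (hp : IsDiscreteOpfibration p)
    {X : K} (e : X ⟶ E) {a b : X ⟶ B} (φ : a ⟶ b) (h : e ≫ p = a) :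
    ∃ (e' : X ⟶ E) (l : e ⟶ e'), l ▷ p ≗ φ := by
  subst h
  obtain ⟨⟨e', l⟩, hl, -⟩ := hp e b φ
  exact ⟨e', l, hl⟩

theorem IsDiscreteOpfibration.unique_of_eq {E B : K} {p : E ⟶ B} (hp : IsDiscreteOpfibration p)
    {X : K} {e e' e₁ e₂ : X ⟶ E} (h : e = e') {l₁ : e ⟶ e₁} {l₂ : e' ⟶ e₂}
    (H : l₁ ▷ p ≗ l₂ ▷ p) : l₁ ≗ l₂ := by
  subst h
  exact hp.unique l₁ l₂ H

theorem IsDiscreteOpfibration.eq_id {E B : K} {p : E ⟶ B} (hp : IsDiscreteOpfibration p)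
    {X : K} {e e' : X ⟶ E} {b : X ⟶ B} {l : e ⟶ e'} (H : l ▷ p ≗ 𝟙 b) : l ≗ 𝟙 e := by
  refine hp.unique l (𝟙 e) (H.trans ?_)
  rw [Bicategory.id_whiskerRight]
  exact TwoCellEq.id_congr H.src.symm

theorem IsDiscreteOpfibration.of_exists_unique {E B : K} {p : E ⟶ B}
    (h : ∀ {X : K} (e : X ⟶ E) (b : X ⟶ B) (φ : e ≫ p ⟶ b), ∃ (e' : X ⟶ E) (l : e ⟶ e'), l ▷ p ≗ φ)
    (h' : ∀ {X : K} {e e₁ e₂ : X ⟶ E} (l₁ : e ⟶ e₁) (l₂ : e ⟶ e₂), l₁ ▷ p ≗ l₂ ▷ p → l₁ ≗ l₂) :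
    IsDiscreteOpfibration p := by
  intro X e b φ
  obtain ⟨e', l, hl⟩ := h e b φ
  exact ⟨⟨e', l⟩, hl, fun l' hl' => (h' l'.2 l (hl'.trans hl.symm)).sigma_eq⟩

theorem isDiscreteOpfibration_id (B : K) : IsDiscreteOpfibration (𝟙 B) := by
  refine IsDiscreteOpfibration.of_exists_unique (fun e b φ => ?_) (fun l₁ l₂ h => ?_)
  · obtain ⟨l, hl⟩ := TwoCellEq.exists_congr (Strict.comp_id e) rfl φ
    exact ⟨b, l, (TwoCellEq.id_right l).trans hl⟩
  · exact (TwoCellEq.id_right l₁).symm.trans (h.trans (TwoCellEq.id_right l₂))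

namespace IsTwoPullback

variable {P A B C : K} {fst : P ⟶ A} {snd : P ⟶ B} {f : A ⟶ C} {g : B ⟶ C}

theorem exists_lift (H : IsTwoPullback fst snd f g) {X : K} (x : X ⟶ A) (y : X ⟶ B)
    (h : x ≫ f = y ≫ g) : ∃ l : X ⟶ P, l ≫ fst = x ∧ l ≫ snd = y :=
  (H.existsUnique_lift x y h).exists

theorem exists_lift₂ (H : IsTwoPullback fst snd f g) {X : K} (h k : X ⟶ P) {a a' : X ⟶ A}
    {b b' : X ⟶ B} (φ : a ⟶ a') (ψ : b ⟶ b') (ha : h ≫ fst = a) (ha' : k ≫ fst = a')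
    (hb : h ≫ snd = b) (hb' : k ≫ snd = b') (w : φ ▷ f ≗ ψ ▷ g) :
    ∃ γ : h ⟶ k, γ ▷ fst ≗ φ ∧ γ ▷ snd ≗ ψ := by
  subst ha ha' hb hb'
  obtain ⟨γ, ⟨h₁, h₂⟩, -⟩ := H.existsUnique_lift₂ h k φ ψ w
  exact ⟨γ, .of_eq h₁, .of_eq h₂⟩

theorem hom₂_ext (H : IsTwoPullback fst snd f g) {X : K} {h k : X ⟶ P} {γ γ' : h ⟶ k}
    (h₁ : γ ▷ fst ≗ γ' ▷ fst) (h₂ : γ ▷ snd ≗ γ' ▷ snd) : γ = γ' := by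
  refine (H.existsUnique_lift₂ h k (γ' ▷ fst) (γ' ▷ snd) ?_).unique ⟨h₁.eq, h₂.eq⟩ ⟨rfl, rfl⟩
  exact (TwoCellEq.assoc_right _ _ _).symm.trans
    ((TwoCellEq.whiskerRight H.w (.refl _)).trans (TwoCellEq.assoc_right _ _ _))

theorem of_exists_ext (w : fst ≫ f = snd ≫ g)
    (h₁ : ∀ {X : K} (x : X ⟶ A) (y : X ⟶ B), x ≫ f = y ≫ g →
      ∃ l : X ⟶ P, l ≫ fst = x ∧ l ≫ snd = y)
    (h₂ : ∀ {X : K} {h k : X ⟶ P}, h ≫ fst = k ≫ fst → h ≫ snd = k ≫ snd → h = k)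
    (h₃ : ∀ {X : K} (h k : X ⟶ P) (φ : h ≫ fst ⟶ k ≫ fst) (ψ : h ≫ snd ⟶ k ≫ snd),
      φ ▷ f ≗ ψ ▷ g → ∃ γ : h ⟶ k, γ ▷ fst ≗ φ ∧ γ ▷ snd ≗ ψ)
    (h₄ : ∀ {X : K} {h k : X ⟶ P} {γ γ' : h ⟶ k}, γ ▷ fst ≗ γ' ▷ fst → γ ▷ snd ≗ γ' ▷ snd →
      γ = γ') : IsTwoPullback fst snd f g where
  w := w
  existsUnique_lift x y h := by
    obtain ⟨l, rfl, rfl⟩ := h₁ x y h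
    exact ⟨l, ⟨rfl, rfl⟩, fun k hk => h₂ hk.1 hk.2⟩
  existsUnique_lift₂ h k φ ψ e := by
    obtain ⟨γ, hγ, hη⟩ := h₃ h k φ ψ e
    exact ⟨γ, ⟨hγ.eq, hη.eq⟩, fun δ hδ =>
      h₄ ((TwoCellEq.of_eq hδ.1).trans hγ.symm) ((TwoCellEq.of_eq hδ.2).trans hη.symm)⟩

/-- Pasting of pullback squares. -/
theorem paste (H : IsTwoPullback fst snd f g) {D E : K} {y : B ⟶ D} {h : C ⟶ E} {k : D ⟶ E}
    (H' : IsTwoPullback g y h k) : IsTwoPullback fst (snd ≫ y) (f ≫ h) k := by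
  refine of_exists_ext ?_ (fun a d e => ?_) (fun {X a b} e e' => ?_) (fun {X} a b φ ψ e => ?_)
    (fun {X a b γ γ'} e e' => ?_)
  · rw [← Strict.assoc, H.w, Strict.assoc, H'.w, Strict.assoc]
  · obtain ⟨b, hb, rfl⟩ := H'.exists_lift (a ≫ f) d (by rw [Strict.assoc, e])
    obtain ⟨l, rfl, rfl⟩ := H.exists_lift a b hb.symm
    exact ⟨l, rfl, (Strict.assoc _ _ _).symm⟩
  · refine H.hom_ext e (H'.hom_ext ?_ ?_)
    · rw [Strict.assoc, Strict.assoc, ← H.w, ← Strict.assoc, e, Strict.assoc]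
    · rw [Strict.assoc, Strict.assoc, e']
  · have hw (c : X ⟶ P) : (c ≫ snd) ≫ g = (c ≫ fst) ≫ f := by rw [Strict.assoc, ← H.w, Strict.assoc]
    -- The 2-cell into `B` is built first from the right-hand square; the left-hand square then
    -- combines it with `φ`.
    obtain ⟨ψ', h₁, h₂⟩ := H'.exists_lift₂ (a ≫ snd) (b ≫ snd) (φ ▷ f) ψ (hw a) (hw b)
      (Strict.assoc _ _ _) (Strict.assoc _ _ _) ((TwoCellEq.assoc_right _ _ _).symm.trans e)
    obtain ⟨γ, h₃, h₄⟩ := H.exists_lift₂ a b φ ψ' rfl rfl rfl rfl h₁.symm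
    exact ⟨γ, h₃, (TwoCellEq.assoc_right _ _ _).trans ((TwoCellEq.whiskerRight rfl h₄).trans h₂)⟩
  · refine H.hom₂_ext e (.of_eq (H'.hom₂_ext ?_ ?_))
    · have hw (δ : a ⟶ b) : δ ▷ snd ▷ g ≗ δ ▷ fst ▷ f :=
        (TwoCellEq.assoc_right _ _ _).symm.trans
          ((TwoCellEq.whiskerRight H.w.symm (.refl _)).trans (TwoCellEq.assoc_right _ _ _))
      exact (hw γ).trans ((TwoCellEq.whiskerRight rfl e).trans (hw γ').symm)
    · exact (TwoCellEq.assoc_right _ _ _).symm.trans (e'.trans (TwoCellEq.assoc_right _ _ _))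

/-- Transport of a pullback square along an isomorphism. -/
theorem of_iso (H : IsTwoPullback fst snd f g) {Q : K} {j : Q ⟶ P} {k : P ⟶ Q} (hjk : j ≫ k = 𝟙 Q)
    (hkj : k ≫ j = 𝟙 P) {q : Q ⟶ A} {r : Q ⟶ B} (hq : j ≫ fst = q) (hr : j ≫ snd = r) :
    IsTwoPullback q r f g := by
  subst hq hr
  have cancel {X : K} (a : X ⟶ Q) : (a ≫ j) ≫ k = a := by rw [Strict.assoc, hjk, Strict.comp_id]
  have cancel₂ {X : K} {a b : X ⟶ Q} (γ : a ⟶ b) : γ ▷ j ▷ k ≗ γ :=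
    (TwoCellEq.assoc_right _ _ _).symm.trans
      ((TwoCellEq.whiskerRight hjk (.refl _)).trans (TwoCellEq.id_right _))
  refine of_exists_ext ?_ (fun a d e => ?_) (fun {X a b} e e' => ?_) (fun a b φ ψ e => ?_)
    (fun {X a b γ γ'} e e' => ?_)
  · rw [Strict.assoc, H.w, Strict.assoc]
  · obtain ⟨l, rfl, rfl⟩ := H.exists_lift a d e
    exact ⟨l ≫ k, by rw [Strict.assoc, ← Strict.assoc k, hkj, Strict.id_comp],
      by rw [Strict.assoc, ← Strict.assoc k, hkj, Strict.id_comp]⟩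
  · have : a ≫ j = b ≫ j := H.hom_ext (by rw [Strict.assoc, e, Strict.assoc])
      (by rw [Strict.assoc, e', Strict.assoc])
    rw [← cancel a, this, cancel]
  · obtain ⟨γ, h₁, h₂⟩ := H.exists_lift₂ (a ≫ j) (b ≫ j) φ ψ (Strict.assoc _ _ _)
      (Strict.assoc _ _ _) (Strict.assoc _ _ _) (Strict.assoc _ _ _) e
    obtain ⟨δ, hδ⟩ := TwoCellEq.exists_congr (cancel a) (cancel b) (γ ▷ k)
    have h (s : P ⟶ A) : δ ▷ (j ≫ s) ≗ γ ▷ s :=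
      (TwoCellEq.whiskerRight rfl hδ).trans <| (TwoCellEq.assoc_right _ _ _).symm.trans <|
        TwoCellEq.whiskerRight (by rw [← Strict.assoc, hkj, Strict.id_comp]) (.refl _)
    have h' (s : P ⟶ B) : δ ▷ (j ≫ s) ≗ γ ▷ s :=
      (TwoCellEq.whiskerRight rfl hδ).trans <| (TwoCellEq.assoc_right _ _ _).symm.trans <|
        TwoCellEq.whiskerRight (by rw [← Strict.assoc, hkj, Strict.id_comp]) (.refl _)
    exact ⟨δ, (h fst).trans h₁, (h' snd).trans h₂⟩
  · have : γ ▷ j = γ' ▷ j := H.hom₂_ext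
      ((TwoCellEq.assoc_right _ _ _).symm.trans (e.trans (TwoCellEq.assoc_right _ _ _)))
      ((TwoCellEq.assoc_right _ _ _).symm.trans (e'.trans (TwoCellEq.assoc_right _ _ _)))
    exact ((cancel₂ γ).symm.trans
      ((TwoCellEq.whiskerRight rfl (.of_eq this)).trans (cancel₂ γ'))).eq

theorem exists_iso (H : IsTwoPullback fst snd f g) {P' : K} {fst' : P' ⟶ A} {snd' : P' ⟶ B}
    (H' : IsTwoPullback fst' snd' f g) : ∃ (j : P ⟶ P') (k : P' ⟶ P), j ≫ k = 𝟙 P ∧ k ≫ j = 𝟙 P' ∧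
      j ≫ fst' = fst ∧ j ≫ snd' = snd ∧ k ≫ fst = fst' ∧ k ≫ snd = snd' := by
  obtain ⟨j, hj, hj'⟩ := H'.exists_lift fst snd H.w
  obtain ⟨k, hk, hk'⟩ := H.exists_lift fst' snd' H'.w
  refine ⟨j, k, H.hom_ext ?_ ?_, H'.hom_ext ?_ ?_, hj, hj', hk, hk'⟩ <;>
    simp only [hj', hk', hj, hk, Strict.assoc, Strict.id_comp]

/-- The square with two opposite identities is a pullback. -/
theorem id_fst (f : A ⟶ B) : IsTwoPullback (𝟙 A) f f (𝟙 B) := by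
  refine of_exists_ext ?_ (fun a d e => ?_) (fun {X a b} e e' => ?_) (fun a b φ ψ e => ?_)
    (fun {X a b γ γ'} e e' => ?_)
  · rw [Strict.id_comp, Strict.comp_id]
  · exact ⟨a, Strict.comp_id a, by rw [e, Strict.comp_id]⟩
  · rwa [Strict.comp_id, Strict.comp_id] at e
  · obtain ⟨γ, hγ⟩ := TwoCellEq.exists_congr (Strict.comp_id a) (Strict.comp_id b) φ
    exact ⟨γ, (TwoCellEq.id_right _).trans hγ,
      (TwoCellEq.whiskerRight rfl hγ).trans (e.trans (TwoCellEq.id_right _))⟩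
  · exact ((TwoCellEq.id_right _).symm.trans (e.trans (TwoCellEq.id_right _))).eq

theorem id_snd (g : A ⟶ B) : IsTwoPullback g (𝟙 A) (𝟙 B) g := by
  refine of_exists_ext ?_ (fun a d e => ?_) (fun {X a b} e e' => ?_) (fun a b φ ψ e => ?_)
    (fun {X a b γ γ'} e e' => ?_)
  · rw [Strict.id_comp, Strict.comp_id]
  · exact ⟨d, by rw [← e, Strict.comp_id], Strict.comp_id d⟩
  · rwa [Strict.comp_id, Strict.comp_id] at e'
  · obtain ⟨γ, hγ⟩ := TwoCellEq.exists_congr (Strict.comp_id a) (Strict.comp_id b) ψ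
    exact ⟨γ, (TwoCellEq.whiskerRight rfl hγ).trans (e.symm.trans (TwoCellEq.id_right _)),
      (TwoCellEq.id_right _).trans hγ⟩
  · exact ((TwoCellEq.id_right _).symm.trans (e'.trans (TwoCellEq.id_right _))).eq

end IsTwoPullback

end StrictTwoCategory

end Plumbus

namespace Plumbus

/-! ### 2-classifiers described by lifts of 2-cells. -/

section Classifiers

variable {K : Type u} [Bicategory.{w, v} K] [Enhanced K]

/-- The projection is again a tight discrete opfibration, and in a plumbus these detect tightness,
so only tightness of the projection has to be supplied. -/
theorem IsPlumbus.isLeftTightPullback (hK : IsPlumbus K) {P A B C : K} {fst : P ⟶ A} {snd : P ⟶ B}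
    {f : A ⟶ C} {g : B ⟶ C} (H : IsTwoPullback fst snd f g) (hg : IsTightDopf g)
    (hfst : IsTight fst) : IsLeftTightPullback fst snd f g :=
  ⟨H, hg.tight, hfst, fun h hh => hK.detects_tight h fst ⟨hfst, H.dopf hg.dopf⟩ hh⟩

theorem isTightDopf_id (B : K) : IsTightDopf (𝟙 B) := ⟨id_tight B, isDiscreteOpfibration_id B⟩

/-- By the universal property of `g^* u`, maps `f^* u ⟶ g^* u` over `B` are maps `z` into `Ωpt`
lying over `g`. Full faithfulness thus becomes the bijection `h`, and essential surjectivity becomes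
`h'`. -/
theorem IsTwoClassifier.mk_of_lift {Small : ∀ {E B : K}, (E ⟶ B) → Prop} {Ωpt Ω : K}
    {u : Ωpt ⟶ Ω} (hK : IsPlumbus K) (hS : IsPullbackIdeal Small) (hu : Small u)
    (h : ∀ {P B : K} {p : P ⟶ B} {x : P ⟶ Ωpt} {f : B ⟶ Ω}, IsLeftTightPullback p x f u →
      ∀ (g : B ⟶ Ω) (z : P ⟶ Ωpt), z ≫ u = p ≫ g → ∃! φ : f ⟶ g, ∃ l : x ⟶ z, l ▷ u ≗ p ◁ φ)
    (h' : ∀ {E B : K} (p : E ⟶ B), Small p →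
      ∃ (d : B ⟶ Ω) (x : E ⟶ Ωpt), IsTwoPullback p x d u) :
    IsTwoClassifier hK Small u where
  small := hu
  tightDopf := hS.tightDopf u hu
  full B := ⟨fun {f g} => by
    suffices H : ∀ k : TdOpfib.Hom (TdOpfib.pullback hK u (hS.tightDopf u hu) f)
      (TdOpfib.pullback hK u (hS.tightDopf u hu) g), ∃ φ : f ⟶ g,
        (TdOpfib.pullbackFunctor hK u (hS.tightDopf u hu) B).map φ = k from H
    intro k
    have Hf := TdOpfib.isLeftTightPullback hK u (hS.tightDopf u hu) f
    have Hg := TdOpfib.isLeftTightPullback hK u (hS.tightDopf u hu) g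
    obtain ⟨φ, ⟨l, hl⟩, -⟩ := h Hf g (k.map ≫ TdOpfib.pullbackSnd hK u (hS.tightDopf u hu) g) (by
      rw [Strict.assoc, ← Hg.w, ← Strict.assoc]
      exact congrArg (· ≫ g) k.w)
    refine ⟨φ, TdOpfib.Hom.ext ?_⟩
    exact (TdOpfib.existsUnique_pullbackMap hK u (hS.tightDopf u hu) φ).unique
      (TdOpfib.existsUnique_pullbackMap hK u (hS.tightDopf u hu) φ).choose_spec.1 ⟨k.w, l, hl⟩⟩
  faithful B := ⟨fun {f g φ ψ} e => by
    have Hf := TdOpfib.isLeftTightPullback hK u (hS.tightDopf u hu) f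
    have Hg := TdOpfib.isLeftTightPullback hK u (hS.tightDopf u hu) g
    have hφ := (TdOpfib.existsUnique_pullbackMap hK u (hS.tightDopf u hu) φ).choose_spec.1
    have hψ := (TdOpfib.existsUnique_pullbackMap hK u (hS.tightDopf u hu) ψ).choose_spec.1
    rw [show (TdOpfib.existsUnique_pullbackMap hK u (hS.tightDopf u hu) φ).choose =
      (TdOpfib.existsUnique_pullbackMap hK u (hS.tightDopf u hu) ψ).choose from
        congrArg TdOpfib.Hom.map e] at hφ
    refine (h Hf g _ ?_).unique hφ.exists_lift hψ.exists_lift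
    rw [Strict.assoc, ← Hg.w, ← Strict.assoc, hψ.w]⟩
  essImage_iff {B} p := by
    constructor
    · rintro ⟨f, ⟨e⟩⟩
      refine hS.replete _ p.hom (hS.pullback _ _ _ _ hu
        (TdOpfib.isLeftTightPullback hK u (hS.tightDopf u hu) f)) p.isTightDopf e.hom.map e.inv.map
        (congrArg TdOpfib.Hom.map e.hom_inv_id) (congrArg TdOpfib.Hom.map e.inv_hom_id) e.hom.w
    · intro hp
      obtain ⟨d, x, H⟩ := h' p.hom hp
      obtain ⟨j, k, hjk, hkj, hj, -, hk, -⟩ :=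
        (TdOpfib.isLeftTightPullback hK u (hS.tightDopf u hu) d).toIsTwoPullback.exists_iso H
      exact ⟨d, ⟨⟨⟨j, hj⟩, ⟨k, hk⟩, TdOpfib.Hom.ext hjk, TdOpfib.Hom.ext hkj⟩⟩⟩

namespace IsRepresentablePlumbus

variable {Small : ∀ {E B : K}, (E ⟶ B) → Prop} {Ωpt Ω : K} {u : Ωpt ⟶ Ω}

theorem tightDopf (hK : IsRepresentablePlumbus Small u) : IsTightDopf u := hK.isTwoClassifier.tightDopf

/-- Let `(p, x)` be a pullback of the 2-classifier `u` along `f`. Then 2-cells `f ⟶ g` correspond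
to maps `z` with `z ≫ u = p ≫ g`. -/
theorem existsUnique_classifier (hK : IsRepresentablePlumbus Small u)
    {P B : K} {p : P ⟶ B} {x : P ⟶ Ωpt} {f : B ⟶ Ω}
    (H : IsTwoPullback p x f u) (g : B ⟶ Ω) (z : P ⟶ Ωpt) (hz : z ≫ u = p ≫ g) :
    ∃! φ : f ⟶ g, ∃ l : x ⟶ z, l ▷ u ≗ p ◁ φ := by
  have Hf := TdOpfib.isLeftTightPullback hK.isPlumbus u hK.tightDopf f
  have Hg := TdOpfib.isLeftTightPullback hK.isPlumbus u hK.tightDopf g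
  obtain ⟨j, k, hjk, hkj, hj, hj', hk, hk'⟩ := H.exists_iso Hf.toIsTwoPullback
  have hw (z' : P ⟶ Ωpt) : (k ≫ z') ≫ u = k ≫ z' ≫ u := Strict.assoc _ _ _
  -- The map `z`, carried to the chosen pullback `f^* u`, is a map `t` over `B` into `g^* u`. The
  -- 2-cells sought are exactly those that the pullback functor sends to `t`.
  obtain ⟨t, ht, ht'⟩ := Hg.exists_lift (TdOpfib.pullback hK.isPlumbus u hK.tightDopf f).hom (k ≫ z)
    (by rw [hw, hz, ← hk, Strict.assoc])
  have hjz : j ≫ t ≫ TdOpfib.pullbackSnd hK.isPlumbus u hK.tightDopf g = z := by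
    rw [ht', ← Strict.assoc, hjk, Strict.id_comp]
  have classifies (φ : f ⟶ g) (l : x ⟶ z) (hl : l ▷ u ≗ p ◁ φ) :
      ((TdOpfib.pullbackFunctor hK.isPlumbus u hK.tightDopf B).map φ) = ⟨t, ht⟩ := by
    obtain ⟨l', hl'⟩ := TwoCellEq.exists_congr hk' ht'.symm (k ◁ l)
    refine TdOpfib.Hom.ext ?_
    refine (TdOpfib.existsUnique_pullbackMap hK.isPlumbus u hK.tightDopf φ).unique
      (TdOpfib.existsUnique_pullbackMap hK.isPlumbus u hK.tightDopf φ).choose_spec.1 ⟨ht, l', ?_⟩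
    refine (TwoCellEq.whiskerRight rfl hl').trans <| (TwoCellEq.assoc_mid _ _ _).trans <|
      (TwoCellEq.whiskerLeft rfl hl).trans <| (TwoCellEq.assoc_left _ _ _).symm.trans <|
      TwoCellEq.whiskerLeft hk (.refl _)
  obtain ⟨φ, hφ⟩ := (hK.isTwoClassifier.full B).map_surjective (X := f) (Y := g) ⟨t, ht⟩
  refine ⟨φ, ?_, ?_⟩
  · have hc := (TdOpfib.existsUnique_pullbackMap hK.isPlumbus u hK.tightDopf φ).choose_spec.1
    rw [show (TdOpfib.existsUnique_pullbackMap hK.isPlumbus u hK.tightDopf φ).choose = t from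
      congrArg TdOpfib.Hom.map hφ] at hc
    obtain ⟨l, hl⟩ := hc.exists_lift
    obtain ⟨l', hl'⟩ := TwoCellEq.exists_congr hj' hjz (j ◁ l)
    exact ⟨l', (TwoCellEq.whiskerRight rfl hl').trans <| (TwoCellEq.assoc_mid _ _ _).trans <|
      (TwoCellEq.whiskerLeft rfl hl).trans <| (TwoCellEq.assoc_left _ _ _).symm.trans <|
      TwoCellEq.whiskerLeft hj (.refl _)⟩
  · rintro ψ ⟨l, hl⟩
    exact (hK.isTwoClassifier.faithful B).map_injective ((classifies ψ l hl).trans hφ.symm)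

/-- 2-cells into the base of a 2-classifier agree as soon as their lifts have the same target. -/
theorem classifier_ext (hK : IsRepresentablePlumbus Small u)
    {P B : K} {p : P ⟶ B} {x : P ⟶ Ωpt} {f₀ f g f' g' : B ⟶ Ω}
    (H : IsTwoPullback p x f₀ u) {φ : f ⟶ g} {ψ : f' ⟶ g'} (hf : f = f₀) (hf' : f' = f₀)
    (hg : g = g') {x₁ z x₂ z' : P ⟶ Ωpt} {l : x₁ ⟶ z} {l' : x₂ ⟶ z'} (hx₁ : x₁ = x) (hx₂ : x₂ = x)
    (hz : z = z') (hl : l ▷ u ≗ p ◁ φ) (hl' : l' ▷ u ≗ p ◁ ψ) : φ ≗ ψ := by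
  subst hf hf' hg hx₁ hx₂ hz
  exact .of_eq ((hK.existsUnique_classifier H g z hl.tgt).unique ⟨l, hl⟩ ⟨l', hl'⟩)

theorem exists_classifying (hK : IsRepresentablePlumbus Small u)
    {E B : K} (p : E ⟶ B) (hp : Small p) :
    ∃ (d : B ⟶ Ω) (x : E ⟶ Ωpt), IsTwoPullback p x d u := by
  obtain ⟨d, ⟨e⟩⟩ := (hK.isTwoClassifier.essImage_iff
    ⟨E, p, hK.isPullbackIdeal.tightDopf p hp⟩).2 hp
  exact ⟨d, _, (TdOpfib.isLeftTightPullback hK.isPlumbus u hK.tightDopf d).toIsTwoPullback.of_iso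
    (congrArg TdOpfib.Hom.map e.inv_hom_id) (congrArg TdOpfib.Hom.map e.hom_inv_id) e.inv.w rfl⟩

/-- The identity of `B` is the pullback of the identity of the terminal object along the map from
`B`. Its classifying map is the starting point of the rigidity argument. -/
theorem small_identity (hK : IsRepresentablePlumbus Small u)
    (B : K) : Small (𝟙 B) := by
  obtain ⟨t, ht⟩ := hK.isPlumbus.exists_terminal
  obtain ⟨f, -⟩ := ht B
  exact hK.isPullbackIdeal.pullback _ f f _ (hK.small_id t ht)
    ⟨IsTwoPullback.id_fst f, id_tight t, id_tight B, fun h hh => by rwa [Strict.comp_id] at hh⟩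

/-- A map classified by the 2-classifier is rigid at a place that admits a 2-cell from a place
where it is trivial. -/
theorem classifier_rigid (hK : IsRepresentablePlumbus Small u)
    {P B : K} {p : P ⟶ B} {x y z : P ⟶ Ωpt} {k : B ⟶ Ω} {c : P ⟶ B}
    (H : IsTwoPullback p x k u) (hz : z ≫ u = p ≫ k) (H' : IsTwoPullback (𝟙 P) y (c ≫ k) u)
    (χ : c ⟶ p) (μ : y ⟶ x) (hμ : μ ▷ u ≗ χ ▷ k) : z = x := by
  -- The map `z` is encoded as an endomorphism `φ` of `k`. It suffices that `φ` becomes trivial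
  -- after composition with `χ ▷ k`, even if `φ` itself is not known to be an identity.
  obtain ⟨φ, ⟨l, hl⟩, -⟩ := hK.existsUnique_classifier H k z hz
  have hy : y ≫ u = c ≫ k := by rw [← H'.w, Strict.id_comp]
  have hu : IsDiscreteOpfibration u := hK.tightDopf.dopf
  obtain ⟨w, m, hm⟩ := hu.exists_lift y (c ◁ φ) hy
  -- The pullback of `u` along `c ≫ k` has projection `𝟙 P`, so `y` is the only map lying over `c ≫
  -- k`.
  have hw : w = y := by
    obtain ⟨t, ht, rfl⟩ := H'.exists_lift (𝟙 P) w (by rw [Strict.id_comp, hm.tgt])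
    obtain rfl : t = 𝟙 P := by rw [← ht, Strict.comp_id]
    exact Strict.id_comp y
  have hc : c ◁ φ = 𝟙 (c ≫ k) := by
    refine (hK.classifier_ext H' (l := m) (l' := 𝟙 y) rfl rfl rfl rfl rfl hw
      (hm.trans (TwoCellEq.id_left _).symm) ?_).eq
    rw [Bicategory.id_whiskerRight, Bicategory.whiskerLeft_id]
    exact TwoCellEq.id_congr (by rw [hy, Strict.id_comp])
  -- Since `c ◁ φ` is an identity, exchange gives `χ ▷ k ≫ p ◁ φ = χ ▷ k`. Then `μ ≫ l` and `μ` lift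
  -- the same 2-cell from the same source, and their targets `z` and `x` coincide.
  have he := whisker_exchange χ φ
  rw [hc, Category.id_comp] at he
  refine (hu.unique (μ ≫ l) μ ?_).tgt
  rw [Bicategory.comp_whiskerRight]
  exact (TwoCellEq.comp' hμ hl).trans ((TwoCellEq.of_eq he.symm).trans hμ.symm)

end IsRepresentablePlumbus

end Classifiers

end Plumbus

namespace Plumbus

namespace Alg

/-! ### Lifting laxators along strict discrete opfibrations. -/

section LiftingLaxators

variable {K : Type u} [Bicategory.{w, v} K] [Enhanced K] {M : EnhancedTwoMonad K}

theorem LaxHom.IsStrict.w {A B : Alg M} {f : LaxHom A B} (hf : f.IsStrict) :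
    M.T.map f.hom ≫ B.str = A.str ≫ f.hom :=
  TwoCellEq.src hf

theorem LaxHom.isStrict_ofStrict {A B : Alg M} (f : A.carrier ⟶ B.carrier)
    (hf : M.T.map f ≫ B.str = A.str ≫ f) : (LaxHom.ofStrict f hf).IsStrict :=
  TwoCellEq.eqToHom_id hf |>.trans (TwoCellEq.id_congr hf)

theorem LaxHom.comp_laxator_of_right {A B C : Alg M} (f : LaxHom A B) {g : LaxHom B C}
    (hg : g.IsStrict) : (f.comp g).laxator ≗ f.laxator ▷ g.hom := by
  refine (f.compLaxator_eq g).trans (TwoCellEq.id_comp_mid (η := M.T.map f.hom ◁ g.laxator) ?_ _ _)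
  refine (TwoCellEq.whiskerLeft rfl hg).trans ?_
  rw [Bicategory.whiskerLeft_id]
  exact TwoCellEq.id_congr (congrArg (M.T.map f.hom ≫ ·) hg.w).symm

theorem LaxHom.comp_laxator_of_left {A B C : Alg M} {f : LaxHom A B} (hf : f.IsStrict)
    (g : LaxHom B C) : (f.comp g).laxator ≗ M.T.map f.hom ◁ g.laxator := by
  refine (f.compLaxator_eq g).trans (TwoCellEq.comp_id_mid (θ := f.laxator ▷ g.hom) ?_ _ _)
  refine (TwoCellEq.whiskerRight rfl hf).trans ?_
  rw [Bicategory.id_whiskerRight]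
  exact TwoCellEq.id_congr (congrArg (· ≫ g.hom) hf.w).symm

theorem hom₂_congr {A B : Alg M} {f g f' g' : A ⟶ B} {η : f ⟶ g} {θ : f' ⟶ g'} (h : η ≗ θ) :
    η.hom₂ ≗ θ.hom₂ := by
  obtain ⟨rfl, rfl, rfl⟩ := h
  exact .of_eq (by simp)

theorem twoCellEq_of_hom₂ {A B : Alg M} {f g f' g' : A ⟶ B} {η : f ⟶ g} {θ : f' ⟶ g'}
    (hf : f = f') (hg : g = g') (h : η.hom₂ ≗ θ.hom₂) : η ≗ θ := by
  subst hf hg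
  exact .of_eq (LaxHom₂.ext h.eq)

/-- Formulated for bare maps satisfying the commutation, so that it also applies to `u`, `ωpt` and
`ω` before `ωpt` is known to be an algebra structure. -/
theorem map₂_whiskerRight_of_comm {E B : K} {p : E ⟶ B} {η : M.T.obj E ⟶ E} {β : M.T.obj B ⟶ B}
    (hp : M.T.map p ≫ β = η ≫ p) {X : K} {f g : X ⟶ E} (γ : f ⟶ g) {f' g' : X ⟶ B} {φ : f' ⟶ g'}
    (h : γ ▷ p ≗ φ) : (M.T.map₂ γ ▷ η) ▷ p ≗ M.T.map₂ φ ▷ β :=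
  (TwoCellEq.assoc_right _ _ _).symm.trans <|
    (TwoCellEq.whiskerRight hp.symm (.refl _)).trans <|
    (TwoCellEq.assoc_right _ _ _).trans <| TwoCellEq.whiskerRight rfl <|
    (TwoCellEq.map₂_right M.T γ p).symm.trans (TwoCellEq.map₂ M.T h)

/-- A laxator may be lifted along a strict discrete opfibration. -/
def LaxHom.lift {X E B : Alg M} {p : LaxHom E B} (hp : p.IsStrict)
    (hd : IsDiscreteOpfibration p.hom) (b : LaxHom X B) (e : X.carrier ⟶ E.carrier)
    (l : M.T.map e ≫ E.str ⟶ X.str ≫ e) (hl : l ▷ p.hom ≗ b.laxator) : LaxHom X E where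
  hom := e
  laxator := l
  unit := by
    have hs : M.i X.carrier ≫ M.T.map e ≫ E.str = e := by
      rw [← Strict.assoc, ← M.i_naturality, Strict.assoc, E.unit, Strict.comp_id]
    -- Over `B` this is the unit law of `b`, and a lift of an identity is an identity.
    refine (hd.eq_id (b := b.hom) ?_).trans (TwoCellEq.id_congr hs)
    exact (TwoCellEq.assoc_mid _ _ _).trans ((TwoCellEq.whiskerLeft rfl hl).trans b.unit)
  mul := by
    -- Both sides have the same source by the algebra law of `E`, and both lift the multiplication
    -- law of `b`.
    refine hd.unique_of_eq ?_ ?_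
    · rw [M.T.map_comp, Strict.assoc, ← E.assoc, ← Strict.assoc, ← M.m_naturality, Strict.assoc]
    · refine (TwoCellEq.assoc_mid _ _ _).trans <| (TwoCellEq.whiskerLeft rfl hl).trans <|
        b.mul.trans <| TwoCellEq.symm <| (TwoCellEq.whiskerRight_mid _ _ _ _).trans ?_
      exact TwoCellEq.compMid (map₂_whiskerRight_of_comm hp.w l hl)
        ((TwoCellEq.assoc_mid _ _ _).trans (TwoCellEq.whiskerLeft rfl hl))

theorem LaxHom.lift_comp {X E B : Alg M} {p : LaxHom E B} (hp : p.IsStrict)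
    (hd : IsDiscreteOpfibration p.hom) (b : LaxHom X B) {e : X.carrier ⟶ E.carrier}
    (l : M.T.map e ≫ E.str ⟶ X.str ≫ e) (hl : l ▷ p.hom ≗ b.laxator) (he : e ≫ p.hom = b.hom) :
    (LaxHom.lift hp hd b e l hl).comp p = b :=
  LaxHom.ext he ((LaxHom.comp_laxator_of_right _ hp).trans hl)

/-- The laxator of `e` is the unique lift, from its given source, of the laxator of `e.comp p`. -/
theorem LaxHom.ext_of_comp {X E B : Alg M} {p : LaxHom E B} (hp : p.IsStrict)
    (hd : IsDiscreteOpfibration p.hom) {e e' : LaxHom X E} (h : e.hom = e'.hom)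
    (h' : e.comp p = e'.comp p) : e = e' := by
  refine LaxHom.ext h (hd.unique_of_eq (by rw [h]) ?_)
  refine (LaxHom.comp_laxator_of_right e hp).symm.trans ?_
  rw [h']
  exact LaxHom.comp_laxator_of_right e' hp

theorem LaxHom.isStrict_of_comp {X E B : Alg M} {p : LaxHom E B} (hp : p.IsStrict)
    (hd : IsDiscreteOpfibration p.hom) {e : LaxHom X E} (h : (e.comp p).IsStrict) :
    e.IsStrict := by
  have := hd.eq_id ((LaxHom.comp_laxator_of_right e hp).symm.trans h)
  exact this.trans (TwoCellEq.id_congr this.tgt.symm)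

/-- Compatibility with laxators may be checked after composition with a strict discrete
opfibration. -/
theorem hom₂_w_of_whiskerRight {X E B : Alg M} {p : LaxHom E B} (hp : p.IsStrict)
    (hd : IsDiscreteOpfibration p.hom) {f g : LaxHom X E} {f' g' : LaxHom X B} (γ : f.hom ⟶ g.hom)
    (hf : f.comp p = f') (hg : g.comp p = g') (Φ : LaxHom₂ f' g') (h : γ ▷ p.hom ≗ Φ.hom₂) :
    M.T.map₂ γ ▷ E.str ≫ g.laxator = f.laxator ≫ X.str ◁ γ := by
  subst hf hg
  refine (hd.unique _ _ ?_).eq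
  rw [Bicategory.comp_whiskerRight, Bicategory.comp_whiskerRight]
  refine (TwoCellEq.comp' (map₂_whiskerRight_of_comm hp.w γ h)
    (LaxHom.comp_laxator_of_right g hp).symm).trans ?_
  refine (TwoCellEq.of_eq Φ.w).trans ?_
  exact TwoCellEq.comp' (LaxHom.comp_laxator_of_right f hp)
    ((TwoCellEq.whiskerLeft rfl h.symm).trans (TwoCellEq.assoc_mid _ _ _).symm)

/-- A strict morphism whose underlying map is a discrete opfibration is one. -/
theorem isDiscreteOpfibration_of_hom {E B : Alg M} {p : E ⟶ B} (hp : LaxHom.IsStrict p)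
    (hd : IsDiscreteOpfibration (LaxHom.hom p)) : IsDiscreteOpfibration p := by
  refine IsDiscreteOpfibration.of_exists_unique (fun {X} e b Φ => ?_) (fun {X} e e₁ e₂ l₁ l₂ h => ?_)
  · obtain ⟨e', l, hl⟩ := hd.exists_lift e.hom Φ.hom₂ rfl
    have hs : (M.T.map e' ≫ E.str) ≫ LaxHom.hom p = M.T.map (LaxHom.hom b) ≫ B.str := by
      rw [Strict.assoc, ← hp.w, ← Strict.assoc, ← M.T.map_comp, hl.tgt]
    -- The only possible laxator of `e'`: the lift of that of `b`. Its target `t` is not yet known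
    -- to be `X.str ≫ e'`.
    obtain ⟨t, L, hL⟩ := hd.exists_lift (M.T.map e' ≫ E.str) (LaxHom.laxator b) hs
    -- Both sides lift the compatibility of `Φ` with laxators. Their equality identifies `t` and
    -- also makes `l` a `T`-2-morphism.
    have key : M.T.map₂ l ▷ E.str ≫ L ≗ e.laxator ≫ X.str ◁ l := by
      refine hd.unique _ _ ?_
      rw [Bicategory.comp_whiskerRight, Bicategory.comp_whiskerRight]
      refine (TwoCellEq.comp' (map₂_whiskerRight_of_comm hp.w l hl) hL).trans ?_
      refine (TwoCellEq.of_eq Φ.w).trans ?_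
      exact TwoCellEq.comp' (LaxHom.comp_laxator_of_right e hp)
        ((TwoCellEq.whiskerLeft rfl hl.symm).trans (TwoCellEq.assoc_mid _ _ _).symm)
    obtain rfl := key.tgt
    exact ⟨LaxHom.lift hp hd b e' L hL, ⟨l, key.eq⟩,
      twoCellEq_of_hom₂ rfl (LaxHom.lift_comp hp hd b L hL hl.tgt) hl⟩
  · have h₁ : l₁.hom₂ ≗ l₂.hom₂ := hd.unique _ _ (hom₂_congr h)
    exact twoCellEq_of_hom₂ rfl (LaxHom.ext_of_comp hp hd h₁.tgt h.tgt) h₁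

end LiftingLaxators

/-! ### Free algebras, and discrete opfibrations of algebras. -/

section FreeAlgebras

variable {K : Type u} [Bicategory.{w, v} K] [Enhanced K] {M : EnhancedTwoMonad K}

/-- The free algebra on an object. -/
def free (M : EnhancedTwoMonad K) (X : K) : Alg M where
  carrier := M.T.obj X
  str := M.m X
  str_tight := M.m_tight X
  unit := M.i_m X
  assoc := (M.assoc X).symm

theorem free_str_comp {X : K} {E : Alg M} (e : X ⟶ E.carrier) :
    M.T.map (M.T.map e ≫ E.str) ≫ E.str = M.m X ≫ M.T.map e ≫ E.str := by
  rw [M.T.map_comp, Strict.assoc, ← E.assoc, ← Strict.assoc, M.m_naturality, Strict.assoc]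

/-- The strict morphism out of a free algebra induced by a map. -/
def freeDesc {X : K} {E : Alg M} (e : X ⟶ E.carrier) : LaxHom (free M X) E :=
  LaxHom.ofStrict (M.T.map e ≫ E.str) (free_str_comp e)

theorem freeDesc_isStrict {X : K} {E : Alg M} (e : X ⟶ E.carrier) : (freeDesc e).IsStrict :=
  LaxHom.isStrict_ofStrict _ (free_str_comp e)

theorem unit_freeDesc {X : K} {E : Alg M} (e : X ⟶ E.carrier) :
    M.i X ≫ M.T.map e ≫ E.str = e := by
  rw [← Strict.assoc, ← M.i_naturality, Strict.assoc, E.unit, Strict.comp_id]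

/-- The `T`-2-morphism out of a free algebra induced by a 2-cell. -/
def freeDesc₂ {X : K} {E : Alg M} {e e' : X ⟶ E.carrier} (φ : e ⟶ e') :
    LaxHom₂ (freeDesc e) (freeDesc e') where
  hom₂ := M.T.map₂ φ ▷ E.str
  w := by
    refine TwoCellEq.eq ((TwoCellEq.eqToHom_right (free_str_comp e') _).trans
      (TwoCellEq.trans ?_ (TwoCellEq.eqToHom_left (free_str_comp e) _).symm))
    refine (TwoCellEq.whiskerRight rfl (TwoCellEq.map₂_right M.T _ _)).trans <|
      (TwoCellEq.assoc_right _ _ _).symm.trans <|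
      (TwoCellEq.whiskerRight E.assoc.symm (.refl _)).trans <|
      (TwoCellEq.assoc_right _ _ _).trans <|
      (TwoCellEq.whiskerRight rfl (M.m_naturality₂ φ)).trans <| TwoCellEq.assoc_mid _ _ _

theorem unit_freeDesc₂ {X : K} {E : Alg M} {e e' : X ⟶ E.carrier} (φ : e ⟶ e') :
    M.i X ◁ (freeDesc₂ (E := E) φ).hom₂ ≗ φ := by
  refine (TwoCellEq.assoc_mid _ _ _).symm.trans <|
    (TwoCellEq.whiskerRight rfl (M.i_naturality₂ φ).symm).trans <|
    (TwoCellEq.assoc_right _ _ _).symm.trans <|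
    (TwoCellEq.whiskerRight E.unit (.refl _)).trans <| TwoCellEq.id_right _

theorem freeDesc_comp {X : K} {E B : Alg M} (e : X ⟶ E.carrier) {p : LaxHom E B}
    (hp : p.IsStrict) {b : X ⟶ B.carrier} (h : e ≫ p.hom = b) :
    (freeDesc e).comp p = freeDesc b := by
  subst h
  have h : (M.T.map e ≫ E.str) ≫ p.hom = M.T.map (e ≫ p.hom) ≫ B.str := by
    rw [Strict.assoc, ← hp.w, ← Strict.assoc, ← M.T.map_comp]
  refine LaxHom.ext h ?_
  exact (LaxHom.isStrict_comp (freeDesc_isStrict e) hp).trans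
    ((TwoCellEq.id_congr (congrArg ((free M X).str ≫ ·) h)).trans (freeDesc_isStrict _).symm)

/-- The map underlying a strict discrete opfibration of algebras is a discrete opfibration. -/
theorem isDiscreteOpfibration_hom {E B : Alg M} {p : E ⟶ B} (hp : LaxHom.IsStrict p)
    (hd : IsDiscreteOpfibration p) : IsDiscreteOpfibration (LaxHom.hom p) := by
  refine IsDiscreteOpfibration.of_exists_unique (fun {X} e b φ => ?_) (fun {X} e e₁ e₂ l₁ l₂ h => ?_)
  · obtain ⟨e', L, hL⟩ := hd.exists_lift (X := free M X) (freeDesc e)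
      (a := freeDesc (e ≫ LaxHom.hom p)) (b := freeDesc b) (freeDesc₂ φ) (freeDesc_comp e hp rfl)
    obtain ⟨l, hl⟩ := TwoCellEq.exists_congr (unit_freeDesc e) rfl (M.i X ◁ L.hom₂)
    refine ⟨_, l, (TwoCellEq.whiskerRight rfl hl).trans ((TwoCellEq.assoc_mid _ _ _).trans ?_)⟩
    exact (TwoCellEq.whiskerLeft rfl (hom₂_congr hL)).trans (unit_freeDesc₂ φ)
  · have hh {a a' : X ⟶ E.carrier} (l : a ⟶ a') :
        (freeDesc₂ (E := E) l).hom₂ ▷ LaxHom.hom p ≗ (freeDesc₂ (l ▷ LaxHom.hom p)).hom₂ :=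
      map₂_whiskerRight_of_comm hp.w l (.refl _)
    have hf := (freeDesc_comp e₁ hp rfl).trans
      ((congrArg freeDesc h.tgt).trans (freeDesc_comp e₂ hp rfl).symm)
    have key := hd.unique (X := free M X) (e := freeDesc e) (e₁ := freeDesc e₁) (e₂ := freeDesc e₂)
      (freeDesc₂ l₁) (freeDesc₂ l₂) (twoCellEq_of_hom₂ rfl hf
        ((hh l₁).trans (TwoCellEq.trans (TwoCellEq.whiskerRight rfl (TwoCellEq.map₂ M.T h))
          (hh l₂).symm)))
    exact (unit_freeDesc₂ l₁).symm.trans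
      ((TwoCellEq.whiskerLeft rfl (hom₂_congr key)).trans (unit_freeDesc₂ l₂))

/-- Reduces questions about tight discrete opfibrations of algebras to `K`, apart from strictness.
-/
theorem isTightDopf_iff {E B : Alg M} {p : E ⟶ B} :
    IsTightDopf p ↔ LaxHom.IsStrict p ∧ IsTightDopf (LaxHom.hom p) :=
  ⟨fun h => ⟨h.tight.1, h.tight.2, isDiscreteOpfibration_hom h.tight.1 h.dopf⟩,
    fun h => ⟨⟨h.1, h.2.tight⟩, isDiscreteOpfibration_of_hom h.1 h.2.dopf⟩⟩

end FreeAlgebras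

/-! ### Pullbacks and the plumbus of algebras. -/

section Pullbacks

variable {K : Type u} [Bicategory.{w, v} K] [Enhanced K] {M : EnhancedTwoMonad K}

/-- A square of lax morphisms with two parallel strict sides, over a pullback of a discrete
opfibration, is a pullback. -/
theorem isTwoPullback_of_hom {P A E B : Alg M} {fst : P ⟶ A} {snd : P ⟶ E} {f : A ⟶ B} {p : E ⟶ B}
    (hfst : LaxHom.IsStrict fst) (hp : LaxHom.IsStrict p)
    (hd : IsDiscreteOpfibration (LaxHom.hom p)) (w : fst ≫ f = snd ≫ p)
    (H : IsTwoPullback (LaxHom.hom fst) (LaxHom.hom snd) (LaxHom.hom f) (LaxHom.hom p)) :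
    IsTwoPullback fst snd f p := by
  have hd' : IsDiscreteOpfibration (LaxHom.hom fst) := H.dopf hd
  refine IsTwoPullback.of_exists_ext w (fun {X} x y e => ?_) (fun {X h k} e e' => ?_)
    (fun {X} h k φ ψ e => ?_) (fun {X h k γ γ'} e e' => ?_)
  · obtain ⟨h, hx, hy⟩ := H.exists_lift (LaxHom.hom x) (LaxHom.hom y) (congrArg LaxHom.hom e)
    -- Since `fst` is strict, the laxator of `h` must lift that of `x`.
    obtain ⟨t, l, hl⟩ := hd'.exists_lift (M.T.map h ≫ P.str) (LaxHom.laxator x) (by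
      rw [Strict.assoc, ← hfst.w, ← Strict.assoc, ← M.T.map_comp, hx])
    have hs : M.T.map h ≫ P.str ≫ LaxHom.hom snd = (M.T.map h ≫ P.str) ≫ LaxHom.hom snd :=
      (Strict.assoc _ _ _).symm
    -- Pasting `l` with the laxator of `snd` gives that of `y`, by unique lifting along `p`.
    -- Comparing targets also shows that `t` and `X.str ≫ h` agree after `snd`.
    have key : M.T.map h ◁ LaxHom.laxator snd ≫ eqToHom hs ≫ l ▷ LaxHom.hom snd ≗
        LaxHom.laxator y := by
      refine hd.unique_of_eq ?_ ?_
      · rw [← Strict.assoc, ← M.T.map_comp, hy]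
      · refine (TwoCellEq.whiskerRight_mid _ _ _ _).trans ?_
        refine TwoCellEq.trans ?_ (LaxHom.comp_laxator_of_right y hp)
        have e' : (LaxHom.comp x f).laxator ≗ (LaxHom.comp y p).laxator := by
          rw [show LaxHom.comp x f = LaxHom.comp y p from e]
          exact .refl _
        refine TwoCellEq.trans (TwoCellEq.compMid (η' := M.T.map (LaxHom.hom x) ◁ LaxHom.laxator f)
          (θ' := LaxHom.laxator x ▷ LaxHom.hom f) ?_ ?_) ((LaxHom.compLaxator_eq x f).symm.trans e')
        · refine (TwoCellEq.assoc_mid _ _ _).trans ?_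
          have e₁ : (LaxHom.comp fst f).laxator ≗ (LaxHom.comp snd p).laxator := by
            rw [show LaxHom.comp fst f = LaxHom.comp snd p from w]
            exact .refl _
          refine (TwoCellEq.whiskerLeft rfl ((LaxHom.comp_laxator_of_right snd hp).symm.trans
            (e₁.symm.trans (LaxHom.comp_laxator_of_left hfst f)))).trans ?_
          refine (TwoCellEq.assoc_left _ _ _).symm.trans (TwoCellEq.whiskerLeft ?_ (.refl _))
          rw [← M.T.map_comp, hx]
        · exact (TwoCellEq.assoc_right _ _ _).symm.trans <|
            (TwoCellEq.whiskerRight H.w.symm (.refl _)).trans <|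
            (TwoCellEq.assoc_right _ _ _).trans (TwoCellEq.whiskerRight rfl hl)
    obtain rfl : t = X.str ≫ h := H.hom_ext (by rw [hl.tgt, Strict.assoc, hx])
      (by rw [key.tgt, Strict.assoc, hy])
    refine ⟨LaxHom.lift hfst hd' x h l hl, LaxHom.lift_comp hfst hd' x l hl hx, ?_⟩
    exact LaxHom.ext hy ((LaxHom.compLaxator_eq _ _).trans key)
  · exact LaxHom.ext_of_comp hfst hd'
      (H.hom_ext (congrArg LaxHom.hom e) (congrArg LaxHom.hom e')) e
  · obtain ⟨γ, h₁, h₂⟩ := H.exists_lift₂ (LaxHom.hom h) (LaxHom.hom k) φ.hom₂ ψ.hom₂ rfl rfl rfl rfl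
      (hom₂_congr e)
    exact ⟨⟨γ, hom₂_w_of_whiskerRight hfst hd' γ rfl rfl φ h₁⟩, twoCellEq_of_hom₂ rfl rfl h₁,
      twoCellEq_of_hom₂ rfl rfl h₂⟩
  · exact LaxHom₂.ext (H.hom₂_ext (hom₂_congr e) (hom₂_congr e'))

theorem isLeftTightPullback_of_hom {P A E B : Alg M} {fst : P ⟶ A} {snd : P ⟶ E} {f : A ⟶ B}
    {p : E ⟶ B} (hfst : LaxHom.IsStrict fst) (hp : LaxHom.IsStrict p)
    (hd : IsDiscreteOpfibration (LaxHom.hom p)) (w : fst ≫ f = snd ≫ p)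
    (H : IsLeftTightPullback (LaxHom.hom fst) (LaxHom.hom snd) (LaxHom.hom f) (LaxHom.hom p)) :
    IsLeftTightPullback fst snd f p where
  toIsTwoPullback := isTwoPullback_of_hom hfst hp hd w H.toIsTwoPullback
  right_tight := ⟨hp, H.right_tight⟩
  left_tight := ⟨hfst, H.left_tight⟩
  detects _ hh := ⟨LaxHom.isStrict_of_comp hfst (H.dopf hd) hh.1, H.detects _ hh.2⟩

/-- Pullbacks of strict discrete opfibrations of algebras are created by the underlying object. -/
theorem exists_pullback {A E B : Alg M} (f : A ⟶ B) {p : E ⟶ B} (hp : LaxHom.IsStrict p)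
    (hd : IsDiscreteOpfibration (LaxHom.hom p)) {P : K} {fst : P ⟶ A.carrier}
    {snd : P ⟶ E.carrier} (H : IsLeftTightPullback fst snd (LaxHom.hom f) (LaxHom.hom p)) :
    ∃ (π : M.T.obj P ⟶ P) (ht : IsTight π) (h₁ : M.i P ≫ π = 𝟙 P) (h₂ : M.m P ≫ π = M.T.map π ≫ π)
      (fst' : (⟨P, π, ht, h₁, h₂⟩ : Alg M) ⟶ A) (snd' : (⟨P, π, ht, h₁, h₂⟩ : Alg M) ⟶ E),
      LaxHom.hom fst' = fst ∧ LaxHom.hom snd' = snd ∧ IsLeftTightPullback fst' snd' f p := by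
  have hsrc : (M.T.map snd ≫ E.str) ≫ LaxHom.hom p =
      M.T.map fst ≫ M.T.map (LaxHom.hom f) ≫ B.str := by
    rw [Strict.assoc, ← hp.w, ← Strict.assoc, ← M.T.map_comp, ← H.w, M.T.map_comp, Strict.assoc]
  -- As `f` is only lax, `Tfst ≫ A.str` and `Tsnd ≫ E.str` need not match over `B`; they differ by
  -- the laxator of `f`. Its lift `l` along `p` replaces the second map by a matching `s`, and `l`
  -- becomes the laxator of `snd`.
  obtain ⟨s, l, hl⟩ := hd.exists_lift (M.T.map snd ≫ E.str) (M.T.map fst ◁ LaxHom.laxator f) hsrc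
  obtain ⟨π, hπ, rfl⟩ := H.exists_lift (M.T.map fst ≫ A.str) s (by rw [hl.tgt, Strict.assoc])
  have ht : IsTight π := H.detects π (by
    rw [hπ]; exact comp_tight (M.map_tight _ H.left_tight) A.str_tight)
  have h₁ : M.i P ≫ π = 𝟙 P := by
    refine H.hom_ext ?_ ?_
    · rw [Strict.assoc, hπ, unit_freeDesc, Strict.id_comp]
    -- This lies over the unit law of `f`, so it is an identity; its target gives the equation after
    -- `snd`.
    · have : M.i P ◁ l ≗ 𝟙 (M.i P ≫ M.T.map snd ≫ E.str) := by
        refine hd.eq_id (b := fst ≫ LaxHom.hom f) ?_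
        refine (TwoCellEq.assoc_mid _ _ _).trans <| (TwoCellEq.whiskerLeft rfl hl).trans <|
          (TwoCellEq.assoc_left _ _ _).symm.trans <|
          (TwoCellEq.whiskerLeft (M.i_naturality fst).symm (.refl _)).trans <|
          (TwoCellEq.assoc_left _ _ _).trans <|
          (TwoCellEq.whiskerLeft rfl (LaxHom.unit f)).trans <| .of_eq (by simp)
      rw [Strict.assoc, this.tgt, unit_freeDesc, Strict.id_comp]
  have h₂ : M.m P ≫ π = M.T.map π ≫ π := by
    refine H.hom_ext ?_ ?_
    · rw [Strict.assoc, hπ, Strict.assoc, hπ, ← Strict.assoc (M.T.map π), ← M.T.map_comp, hπ,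
        free_str_comp]
    · have hmid : M.T.map (π ≫ snd) ≫ E.str = M.T.map π ≫ M.T.map snd ≫ E.str := by
        rw [M.T.map_comp, Strict.assoc]
      -- Both sides lift the multiplication law of `f`, and the equality of their targets is what is
      -- needed.
      have : M.m P ◁ l ≗ M.T.map₂ l ▷ E.str ≫ eqToHom hmid ≫ M.T.map π ◁ l := by
        refine hd.unique_of_eq (free_str_comp snd).symm ?_
        refine (TwoCellEq.assoc_mid _ _ _).trans <| (TwoCellEq.whiskerLeft rfl hl).trans <|
          (TwoCellEq.assoc_left _ _ _).symm.trans <|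
          (TwoCellEq.whiskerLeft (M.m_naturality fst).symm (.refl _)).trans <|
          (TwoCellEq.assoc_left _ _ _).trans <|
          (TwoCellEq.whiskerLeft rfl (LaxHom.mul f)).trans <|
          (TwoCellEq.whiskerLeft_mid _ _ _ _).trans <| TwoCellEq.symm <|
          (TwoCellEq.whiskerRight_mid _ _ _ _).trans ?_
        refine TwoCellEq.compMid ?_ ?_
        · exact (map₂_whiskerRight_of_comm hp.w l hl).trans <|
            (TwoCellEq.whiskerRight rfl (TwoCellEq.map₂_left M.T _ _)).trans <|
            TwoCellEq.assoc_mid _ _ _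
        · refine (TwoCellEq.assoc_mid _ _ _).trans <| (TwoCellEq.whiskerLeft rfl hl).trans <|
            (TwoCellEq.assoc_left _ _ _).symm.trans <|
            (TwoCellEq.whiskerLeft ?_ (.refl _)).trans <| TwoCellEq.assoc_left _ _ _
          rw [← M.T.map_comp, hπ, M.T.map_comp]
      rw [Strict.assoc, this.tgt, Strict.assoc]
  let Q : Alg M := ⟨P, π, ht, h₁, h₂⟩
  let fst' : LaxHom Q A := LaxHom.ofStrict fst hπ.symm
  have hfst' : fst'.IsStrict := LaxHom.isStrict_ofStrict (A := Q) fst hπ.symm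
  have hl' : l ▷ LaxHom.hom p ≗ (LaxHom.comp fst' f).laxator :=
    hl.trans (LaxHom.comp_laxator_of_left hfst' f).symm
  let snd' : LaxHom Q E := LaxHom.lift hp hd (LaxHom.comp fst' f) snd l hl'
  have hw : LaxHom.comp fst' f = LaxHom.comp snd' p :=
    (LaxHom.lift_comp hp hd (LaxHom.comp fst' f) l hl' H.w.symm).symm
  exact ⟨π, ht, h₁, h₂, fst', snd', rfl, rfl, isLeftTightPullback_of_hom hfst' hp hd hw H⟩

theorem isTightTerminal_mk {t : K} (ht : IsTightTerminal t) : ∃ A : Alg M, IsTightTerminal A := by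
  have hom_eq {X : K} (f g : X ⟶ t) : f = g := by
    obtain ⟨h, -, hu, -⟩ := ht X
    rw [hu f, hu g]
  have tight {X : K} (f : X ⟶ t) : IsTight f := by
    obtain ⟨h, hh, hu, -⟩ := ht X
    rwa [hu f]
  have hom₂_eq {X : K} {f g f' g' : X ⟶ t} (η : f ⟶ g) (θ : f' ⟶ g') : η ≗ θ := by
    obtain ⟨h, -, hu, hη⟩ := ht X
    obtain rfl := hu f
    obtain rfl := hu g
    obtain rfl := hu f'
    obtain rfl := hu g'
    rw [hη η, hη θ]
    exact .refl _
  obtain ⟨τ, hτ, -⟩ := ht (M.T.obj t)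
  let A : Alg M := ⟨t, τ, hτ, hom_eq _ _, hom_eq _ _⟩
  refine ⟨A, fun X => ?_⟩
  obtain ⟨f, -⟩ := ht X.carrier
  have hf : M.T.map f ≫ A.str = X.str ≫ f := hom_eq _ _
  refine ⟨LaxHom.ofStrict f hf, ⟨LaxHom.isStrict_ofStrict (B := A) f hf, tight f⟩,
    fun g => LaxHom.ext (hom_eq _ _) (hom₂_eq _ _), fun η => LaxHom₂.ext (hom₂_eq _ _).eq⟩

theorem isPlumbus (hK : IsPlumbus K) : IsPlumbus (Alg M) where
  exists_terminal := by
    obtain ⟨t, ht⟩ := hK.exists_terminal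
    exact isTightTerminal_mk ht
  exists_pullback f p hp := by
    obtain ⟨hs, hp'⟩ := isTightDopf_iff.1 hp
    obtain ⟨P, fst, snd, H⟩ := hK.exists_pullback (LaxHom.hom f) (LaxHom.hom p) hp'
    obtain ⟨_, _, _, _, fst', snd', -, -, H'⟩ := exists_pullback f hs hp'.dopf H
    exact ⟨_, fst', snd', H'⟩
  detects_tight e p hp h := by
    obtain ⟨hs, hp'⟩ := isTightDopf_iff.1 hp
    exact ⟨LaxHom.isStrict_of_comp hs hp'.dopf h.1, hK.detects_tight _ _ hp' h.2⟩

/-- The underlying square of a pullback of a tight discrete opfibration of algebras is a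
pullback. -/
theorem isTwoPullback_hom (hK : IsPlumbus K) {P A E B : Alg M} {fst : P ⟶ A} {snd : P ⟶ E}
    {f : A ⟶ B} {p : E ⟶ B} (hp : IsTightDopf p) (H : IsTwoPullback fst snd f p) :
    IsTwoPullback (LaxHom.hom fst) (LaxHom.hom snd) (LaxHom.hom f) (LaxHom.hom p) := by
  obtain ⟨hs, hp'⟩ := isTightDopf_iff.1 hp
  obtain ⟨Q, q, r, HQ⟩ := hK.exists_pullback (LaxHom.hom f) (LaxHom.hom p) hp'
  -- The given pullback is isomorphic to one created from `K`, and the isomorphism descends to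
  -- carriers.
  obtain ⟨_, _, _, _, q', r', rfl, rfl, H'⟩ := exists_pullback f hs hp'.dopf HQ
  obtain ⟨j, k, hjk, hkj, hj, hj', -, -⟩ := H.exists_iso H'.toIsTwoPullback
  exact HQ.toIsTwoPullback.of_iso (congrArg LaxHom.hom hjk) (congrArg LaxHom.hom hkj)
    (congrArg LaxHom.hom hj) (congrArg LaxHom.hom hj')

theorem isPullbackIdeal (hK : IsPlumbus K) {S : ∀ {E B : K}, (E ⟶ B) → Prop}
    (hS : IsPullbackIdeal S) : IsPullbackIdeal (K := Alg M) (Small S) where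
  tightDopf _ hp := hp.1
  replete _ _ hp hp' h k hk hk' hw := ⟨hp', hS.replete _ _ hp.2 (isTightDopf_iff.1 hp').2
    (LaxHom.hom h) (LaxHom.hom k) (congrArg LaxHom.hom hk) (congrArg LaxHom.hom hk')
    (congrArg LaxHom.hom hw)⟩
  pullback _ _ _ _ hp H := ⟨H.tightDopf hp.1, hS.pullback _ _ _ _ hp.2
    (hK.isLeftTightPullback (isTwoPullback_hom hK hp.1 H.toIsTwoPullback) (isTightDopf_iff.1 hp.1).2
      H.left_tight.2)⟩

end Pullbacks

end Alg

end Plumbus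

namespace Plumbus

/-! ### The algebra structure on the total object of the classifier. -/

section ClassifierAlgebra

variable {K : Type u} [Bicategory.{w, v} K] [Enhanced K]

/-- A 2-monad preserving pullbacks of `u`, together with a classifying map `ω` of `Tu`, turns
pullbacks of `u` along `f` into pullbacks of `u` along `T.map f ≫ ω`. -/
theorem IsRepresentablePlumbus.map_pullback {Small : ∀ {E B : K}, (E ⟶ B) → Prop} {Ωpt Ω : K}
    {u : Ωpt ⟶ Ω} (hK : IsRepresentablePlumbus Small u) {M : EnhancedTwoMonad K}
    (hT : ∀ {P B : K} (p : P ⟶ B) (x : P ⟶ Ωpt) (f : B ⟶ Ω), IsLeftTightPullback p x f u →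
      IsTwoPullback (M.T.map p) (M.T.map x) (M.T.map f) (M.T.map u))
    {ω : M.T.obj Ω ⟶ Ω} {ωpt : M.T.obj Ωpt ⟶ Ωpt} (hω : IsTwoPullback (M.T.map u) ωpt ω u)
    {P B : K} {p : P ⟶ B} {x : P ⟶ Ωpt} {f : B ⟶ Ω} (H : IsTwoPullback p x f u) (hp : IsTight p) :
    IsTwoPullback (M.T.map p) (M.T.map x ≫ ωpt) (M.T.map f ≫ ω) u :=
  (hT p x f (hK.isPlumbus.isLeftTightPullback H hK.tightDopf hp)).paste hω

/-- Any map exhibiting `Tu` as the pullback of the 2-classifier `u` along an algebra structure is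
an algebra structure. -/
theorem IsRepresentablePlumbus.algebra_structure {Small : ∀ {E B : K}, (E ⟶ B) → Prop}
    {Ωpt Ω : K} {u : Ωpt ⟶ Ω} (hK : IsRepresentablePlumbus Small u) {M : EnhancedTwoMonad K}
    (hT : ∀ {P B : K} (p : P ⟶ B) (x : P ⟶ Ωpt) (f : B ⟶ Ω), IsLeftTightPullback p x f u →
      IsTwoPullback (M.T.map p) (M.T.map x) (M.T.map f) (M.T.map u))
    {ω : M.T.obj Ω ⟶ Ω} {ωpt : M.T.obj Ωpt ⟶ Ωpt} (hω : IsTwoPullback (M.T.map u) ωpt ω u)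
    (hω_tight : IsTight ω) (hω_unit : M.i Ω ≫ ω = 𝟙 Ω) (hω_assoc : M.m Ω ≫ ω = M.T.map ω ≫ ω) :
    IsTight ωpt ∧ M.i Ωpt ≫ ωpt = 𝟙 Ωpt ∧ M.m Ωpt ≫ ωpt = M.T.map ωpt ≫ ωpt := by
  have hu := hK.tightDopf
  -- Here `c` classifies the identity of `Ωpt`, and `χ : c ⟶ u` is the 2-cell whose lift from `y`
  -- ends at `𝟙 Ωpt`.
  obtain ⟨c, y, Hc⟩ := hK.exists_classifying (𝟙 Ωpt) (hK.small_identity Ωpt)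
  obtain ⟨χ, ⟨μ, hμ⟩, -⟩ := hK.existsUnique_classifier Hc u (𝟙 Ωpt) rfl
  replace hμ : μ ▷ u ≗ χ := hμ.trans (TwoCellEq.id_left _)
  refine ⟨hK.isPlumbus.detects_tight _ u hu ?_, ?_, ?_⟩
  · rw [← hω.w]
    exact comp_tight (M.map_tight u hu.tight) hω_tight
  · refine hK.classifier_rigid (IsTwoPullback.id_snd u) (y := y) (c := c) ?_ ?_ χ μ
      (hμ.trans (TwoCellEq.id_right _).symm)
    · rw [Strict.assoc, ← hω.w, ← Strict.assoc, ← M.i_naturality, Strict.assoc, hω_unit]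
    · rwa [Strict.comp_id]
  · have Hu := hK.map_pullback hT hω hω (M.map_tight u hu.tight)
    -- Applying `T` twice to the pullback for `c` still yields an identity projection, so rigidity
    -- applies at `k = Tω ≫ ω` with 2-cell `TTχ`.
    have Hc' := hK.map_pullback hT hω (hK.map_pullback hT hω Hc (id_tight _))
      (M.map_tight _ (id_tight _))
    have ht : M.T.map (M.T.map (𝟙 Ωpt) ≫ ωpt) ≫ ωpt = M.T.map ωpt ≫ ωpt := by
      rw [M.T.map_id, Strict.id_comp]
    have hs : M.T.map (M.T.map c ≫ ω) ≫ ω = M.T.map (M.T.map c) ≫ M.T.map ω ≫ ω := by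
      rw [M.T.map_comp, Strict.assoc]
    rw [M.T.map_id, M.T.map_id, hs] at Hc'
    obtain ⟨ν, hν⟩ := TwoCellEq.exists_congr rfl ht (M.T.map₂ (M.T.map₂ μ ▷ ωpt) ▷ ωpt)
    refine hK.classifier_rigid Hu ?_ Hc' (M.T.map₂ (M.T.map₂ χ)) ν ?_
    · rw [Strict.assoc, ← hω.w, ← Strict.assoc, ← M.m_naturality, Strict.assoc, hω_assoc]
    · refine (TwoCellEq.whiskerRight rfl hν).trans <|
        (Alg.map₂_whiskerRight_of_comm hω.w _
          (Alg.map₂_whiskerRight_of_comm hω.w _ hμ)).trans <|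
        (TwoCellEq.whiskerRight rfl (TwoCellEq.map₂_right M.T _ _)).trans
        (TwoCellEq.assoc_right _ _ _).symm

end ClassifierAlgebra

namespace Alg

/-! ### Lifting the 2-classifier to algebras. -/

section Lifting

variable {K : Type u} [Bicategory.{w, v} K] [Enhanced K] {M : EnhancedTwoMonad K}
  {S : ∀ {E B : K}, (E ⟶ B) → Prop} {Apt A : Alg M} {U : Apt ⟶ A}

theorem isTightDopf_classifier (hK : IsRepresentablePlumbus S (LaxHom.hom U))
    (hU : LaxHom.IsStrict U) : IsTightDopf U :=
  isTightDopf_iff.2 ⟨hU, hK.tightDopf⟩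

/-- As `p` and `U` are strict, each composite in the commuting square has as laxator just a
whiskering of the laxator of its lax factor. -/
theorem laxator_lift (hU : LaxHom.IsStrict U) {E B : Alg M} {p : E ⟶ B}
    (hs : LaxHom.IsStrict p) {D : B ⟶ A} {X : E ⟶ Apt}
    (w : p ≫ D = X ≫ U) : LaxHom.laxator X ▷ LaxHom.hom U ≗
      M.T.map (LaxHom.hom p) ◁ LaxHom.laxator D := by
  refine (LaxHom.comp_laxator_of_right X hU).symm.trans ?_
  rw [show LaxHom.comp X U = LaxHom.comp p D from w.symm]
  exact LaxHom.comp_laxator_of_left hs D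

/-- The lift is taken over the pullback `(Tp, Tx ≫ Apt.str)`; its prescribed end `E.str ≫ x` lies
over `B.str ≫ d` because `p` is strict. -/
theorem existsUnique_laxator (hK : IsRepresentablePlumbus S (LaxHom.hom U))
    (hT : ∀ {P B : K} (p : P ⟶ B) (x : P ⟶ Apt.carrier) (f : B ⟶ A.carrier),
      IsLeftTightPullback p x f (LaxHom.hom U) →
        IsTwoPullback (M.T.map p) (M.T.map x) (M.T.map f) (M.T.map (LaxHom.hom U)))
    (hω : IsTwoPullback (M.T.map (LaxHom.hom U)) Apt.str A.str (LaxHom.hom U))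
    {E B : Alg M} {p : E ⟶ B} (hs : LaxHom.IsStrict p)
    (hp : IsTight (LaxHom.hom p)) {d : B.carrier ⟶ A.carrier} {x : E.carrier ⟶ Apt.carrier}
    (H : IsTwoPullback (LaxHom.hom p) x d (LaxHom.hom U)) :
    ∃! φ : M.T.map d ≫ A.str ⟶ B.str ≫ d, ∃ l : M.T.map x ≫ Apt.str ⟶ E.str ≫ x,
      l ▷ LaxHom.hom U ≗ M.T.map (LaxHom.hom p) ◁ φ := by
  refine hK.existsUnique_classifier (hK.map_pullback hT hω H hp) _ _ ?_
  rw [Strict.assoc, ← H.w, ← Strict.assoc, ← hs.w, Strict.assoc]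

/-- The two sides of each law for `φ` have lifts built from `l`, and the ends of these lifts agree
by the unit and associativity laws of `E`. Once `D` is a lax morphism, `l` becomes the laxator of
`X` by lifting along `U`. -/
theorem exists_lax_square (hK : IsRepresentablePlumbus S (LaxHom.hom U)) (hU : LaxHom.IsStrict U)
    (hT : ∀ {P B : K} (p : P ⟶ B) (x : P ⟶ Apt.carrier) (f : B ⟶ A.carrier),
      IsLeftTightPullback p x f (LaxHom.hom U) →
        IsTwoPullback (M.T.map p) (M.T.map x) (M.T.map f) (M.T.map (LaxHom.hom U)))
    (hω : IsTwoPullback (M.T.map (LaxHom.hom U)) Apt.str A.str (LaxHom.hom U))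
    {E B : Alg M} {p : E ⟶ B} (hs : LaxHom.IsStrict p)
    (hp : IsTight (LaxHom.hom p)) {d : B.carrier ⟶ A.carrier} {x : E.carrier ⟶ Apt.carrier}
    (H : IsTwoPullback (LaxHom.hom p) x d (LaxHom.hom U)) :
    ∃ (D : B ⟶ A) (X : E ⟶ Apt), LaxHom.hom D = d ∧ LaxHom.hom X = x ∧ p ≫ D = X ≫ U := by
  have hd : IsDiscreteOpfibration (LaxHom.hom U) := hK.tightDopf.dopf
  obtain ⟨φ, ⟨l, hl⟩, -⟩ := existsUnique_laxator hK hT hω hs hp H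
  have HT := hK.map_pullback hT hω (hK.map_pullback hT hω H hp) (M.map_tight _ hp)
  let D : LaxHom B A :=
    { hom := d
      laxator := φ
      unit := by
        refine hK.classifier_ext H (l := M.i E.carrier ◁ l) (l' := 𝟙 x) (unit_freeDesc d) rfl ?_
          (unit_freeDesc x) rfl ?_ ?_ ?_
        · rw [← Strict.assoc, B.unit, Strict.id_comp]
        · rw [← Strict.assoc, E.unit, Strict.id_comp]
        · exact (TwoCellEq.assoc_mid _ _ _).trans <| (TwoCellEq.whiskerLeft rfl hl).trans <|
            (TwoCellEq.assoc_left _ _ _).symm.trans <|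
            (TwoCellEq.whiskerLeft (M.i_naturality _).symm (.refl _)).trans <|
            TwoCellEq.assoc_left _ _ _
        · rw [Bicategory.id_whiskerRight, Bicategory.whiskerLeft_id]
          exact TwoCellEq.id_congr H.w.symm
      mul := by
        -- The multiplication law compares 2-cells out of `TTB`, so it is tested on the pullback
        -- obtained by applying `T` twice.
        refine hK.classifier_ext HT (l := M.m E.carrier ◁ l)
          (l' := M.T.map₂ l ▷ Apt.str ≫ eqToHom (lax_source_eq E Apt x) ≫ M.T.map E.str ◁ l)
          (free_str_comp d).symm rfl ?_ (free_str_comp x).symm rfl ?_ ?_ ?_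
        · rw [← Strict.assoc, B.assoc, Strict.assoc]
        · rw [← Strict.assoc, E.assoc, Strict.assoc]
        · exact (TwoCellEq.assoc_mid _ _ _).trans <| (TwoCellEq.whiskerLeft rfl hl).trans <|
            (TwoCellEq.assoc_left _ _ _).symm.trans <|
            (TwoCellEq.whiskerLeft (M.m_naturality _).symm (.refl _)).trans <|
            TwoCellEq.assoc_left _ _ _
        · refine (TwoCellEq.whiskerRight_mid _ _ _ _).trans <| TwoCellEq.trans ?_
            (TwoCellEq.whiskerLeft_mid _ _ _ _).symm
          refine TwoCellEq.compMid ?_ ?_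
          · exact (map₂_whiskerRight_of_comm hω.w l hl).trans <|
              (TwoCellEq.whiskerRight rfl (TwoCellEq.map₂_left M.T _ _)).trans <|
              TwoCellEq.assoc_mid _ _ _
          · refine (TwoCellEq.assoc_mid _ _ _).trans <| (TwoCellEq.whiskerLeft rfl hl).trans <|
              (TwoCellEq.assoc_left _ _ _).symm.trans <|
              (TwoCellEq.whiskerLeft ?_ (.refl _)).trans <| TwoCellEq.assoc_left _ _ _
            rw [← M.T.map_comp, ← hs.w, M.T.map_comp] }
  have hl' : l ▷ LaxHom.hom U ≗ (LaxHom.comp p D).laxator :=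
    hl.trans (LaxHom.comp_laxator_of_left hs D).symm
  exact ⟨D, LaxHom.lift hU hd (LaxHom.comp p D) x l hl', rfl, rfl,
    (LaxHom.lift_comp hU hd (LaxHom.comp p D) l hl' H.w.symm).symm⟩

/-- Pulling back the classifier along lax morphisms is fully faithful. -/
theorem existsUnique_classifier (hK : IsRepresentablePlumbus S (LaxHom.hom U)) (hU : LaxHom.IsStrict U)
    (hT : ∀ {P B : K} (p : P ⟶ B) (x : P ⟶ Apt.carrier) (f : B ⟶ A.carrier),
      IsLeftTightPullback p x f (LaxHom.hom U) →
        IsTwoPullback (M.T.map p) (M.T.map x) (M.T.map f) (M.T.map (LaxHom.hom U)))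
    (hω : IsTwoPullback (M.T.map (LaxHom.hom U)) Apt.str A.str (LaxHom.hom U))
    {P B : Alg M} {p : P ⟶ B} {X : P ⟶ Apt} {D : B ⟶ A}
    (H : IsLeftTightPullback p X D U) (G : B ⟶ A) (Z : P ⟶ Apt) (hZ : Z ≫ U = p ≫ G) :
    ∃! φ : D ⟶ G, ∃ l : X ⟶ Z, l ▷ U ≗ p ◁ φ := by
  have hd : IsDiscreteOpfibration (LaxHom.hom U) := hK.tightDopf.dopf
  have H' := isTwoPullback_hom hK.isPlumbus (isTightDopf_classifier hK hU) H.toIsTwoPullback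
  obtain ⟨hs, hp⟩ := H.left_tight
  obtain ⟨φ, ⟨l, hl⟩, hφ⟩ := hK.existsUnique_classifier H' (LaxHom.hom G) (LaxHom.hom Z)
    (congrArg LaxHom.hom hZ)
  -- Over `TP`, both sides have lifts from `TX ≫ Apt.str` to `P.str ≫ Z`, made from `l` and the
  -- laxators of `Z` and `X`. They share an end, so the 2-cells agree.
  have key : M.T.map₂ φ ▷ A.str ≫ LaxHom.laxator G = LaxHom.laxator D ≫ B.str ◁ φ := by
    refine (hK.classifier_ext (hK.map_pullback hT hω H' hp)
      (l := M.T.map₂ l ▷ Apt.str ≫ LaxHom.laxator Z) (l' := LaxHom.laxator X ≫ P.str ◁ l)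
      rfl rfl rfl rfl rfl rfl ?_ ?_).eq
    · rw [Bicategory.comp_whiskerRight, Bicategory.whiskerLeft_comp]
      refine TwoCellEq.comp' ?_ (laxator_lift hU hs hZ.symm)
      exact (map₂_whiskerRight_of_comm hω.w l hl).trans <|
        (TwoCellEq.whiskerRight rfl (TwoCellEq.map₂_left M.T _ _)).trans <|
        TwoCellEq.assoc_mid _ _ _
    · rw [Bicategory.comp_whiskerRight, Bicategory.whiskerLeft_comp]
      refine TwoCellEq.comp' (laxator_lift hU hs H.w) ?_
      exact (TwoCellEq.assoc_mid _ _ _).trans <| (TwoCellEq.whiskerLeft rfl hl).trans <|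
        (TwoCellEq.assoc_left _ _ _).symm.trans <|
        (TwoCellEq.whiskerLeft hs.w.symm (.refl _)).trans <| TwoCellEq.assoc_left _ _ _
  let Φ : LaxHom₂ D G := ⟨φ, key⟩
  refine ⟨Φ, ⟨⟨l, hom₂_w_of_whiskerRight hU hd l H.w.symm hZ (LaxHom₂.whiskerLeft p Φ) hl⟩,
    twoCellEq_of_hom₂ H.w.symm hZ hl⟩, ?_⟩
  rintro Ψ ⟨m, hm⟩
  exact LaxHom₂.ext (hφ Ψ.hom₂ ⟨m.hom₂, hom₂_congr hm⟩)

/-- For uniqueness, the laxators of any two choices of `X` lift the corresponding laxators of `D`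
and have the same ends, which depend only on `x`. -/
theorem exists_classifying (hK : IsRepresentablePlumbus S (LaxHom.hom U)) (hU : LaxHom.IsStrict U)
    (hT : ∀ {P B : K} (p : P ⟶ B) (x : P ⟶ Apt.carrier) (f : B ⟶ A.carrier),
      IsLeftTightPullback p x f (LaxHom.hom U) →
        IsTwoPullback (M.T.map p) (M.T.map x) (M.T.map f) (M.T.map (LaxHom.hom U)))
    (hω : IsTwoPullback (M.T.map (LaxHom.hom U)) Apt.str A.str (LaxHom.hom U))
    {E B : Alg M} {p : E ⟶ B} (hs : LaxHom.IsStrict p)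
    (hp : IsTight (LaxHom.hom p)) {d : B.carrier ⟶ A.carrier} {x : E.carrier ⟶ Apt.carrier}
    (H : IsTwoPullback (LaxHom.hom p) x d (LaxHom.hom U)) :
    ∃! D : B ⟶ A, LaxHom.hom D = d ∧ ∃ X : E ⟶ Apt, LaxHom.hom X = x ∧ IsTwoPullback p X D U := by
  obtain ⟨D, X, rfl, rfl, w⟩ := exists_lax_square hK hU hT hω hs hp H
  refine ⟨D, ⟨rfl, X, rfl, isTwoPullback_of_hom hs hU hK.tightDopf.dopf w H⟩, ?_⟩
  rintro D' ⟨hD', X', hX, H'⟩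
  refine LaxHom.ext hD' ?_
  refine hK.classifier_ext (hK.map_pullback hT hω H hp) (l := LaxHom.laxator X')
    (l' := LaxHom.laxator X) ?_ rfl ?_ ?_ rfl ?_ (laxator_lift hU hs H'.w) (laxator_lift hU hs w)
  · rw [hD']
  · rw [hD']
  · rw [hX]
  · rw [hX]

/-- Algebras over a representable plumbus form a representable plumbus. -/
theorem isRepresentablePlumbus (hK : IsRepresentablePlumbus S (LaxHom.hom U)) (hU : LaxHom.IsStrict U)
    (hT : ∀ {P B : K} (p : P ⟶ B) (x : P ⟶ Apt.carrier) (f : B ⟶ A.carrier),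
      IsLeftTightPullback p x f (LaxHom.hom U) →
        IsTwoPullback (M.T.map p) (M.T.map x) (M.T.map f) (M.T.map (LaxHom.hom U)))
    (hω : IsTwoPullback (M.T.map (LaxHom.hom U)) Apt.str A.str (LaxHom.hom U)) :
    IsRepresentablePlumbus (K := Alg M) (Small S) U where
  isPlumbus := isPlumbus hK.isPlumbus
  isPullbackIdeal := isPullbackIdeal hK.isPlumbus hK.isPullbackIdeal
  small_id t _ := ⟨isTightDopf_id t, hK.small_identity t.carrier⟩
  isTwoClassifier := IsTwoClassifier.mk_of_lift _ (isPullbackIdeal hK.isPlumbus hK.isPullbackIdeal)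
    ⟨isTightDopf_classifier hK hU, hK.isTwoClassifier.small⟩
    (fun H => existsUnique_classifier hK hU hT hω H) (fun p hp => by
      obtain ⟨d, x, H⟩ := hK.exists_classifying (LaxHom.hom p) hp.2
      obtain ⟨D, ⟨-, X, -, H'⟩, -⟩ := exists_classifying hK hU hT hω hp.1.tight.1 hp.1.tight.2 H
      exact ⟨D, X, H'⟩)

end Lifting

end Alg

end Plumbus

/-- The lifting theorem. The second part describes the classifying maps of the small discrete
opfibrations `p : E ⟶ B` of algebras: every classifying map `d` of the underlying map of `p` carries
a unique lax structure making it a classifying map of `p`, and the laxator of a classifying map,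
as a 2-cell between classifying maps of `Tp` and of the pullback of `p` along the structure map
of `B`, classifies the `T`-cartesianity defect of `p`. -/
theorem mainTheorem1 {K : Type u} [Bicategory.{w, v} K] [Enhanced K]
    (Small : ∀ {E B : K}, (E ⟶ B) → Prop) {Ωpt Ω : K} (u : Ωpt ⟶ Ω)
    (hK : IsRepresentablePlumbus Small u) (M : EnhancedTwoMonad K)
    -- `Tu` is a small discrete opfibration
    (hTu : Small (M.T.map u))
    -- `T` preserves pullbacks of `u`
    (hT : ∀ {P B : K} (p : P ⟶ B) (x : P ⟶ Ωpt) (f : B ⟶ Ω), IsLeftTightPullback p x f u →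
      IsTwoPullback (M.T.map p) (M.T.map x) (M.T.map f) (M.T.map u))
    -- the unit and the multiplication are cartesian at `u`
    (hi : IsTwoPullback u (M.i Ωpt) (M.i Ω) (M.T.map u))
    (hm : IsTwoPullback (M.T.map (M.T.map u)) (M.m Ωpt) (M.m Ω) (M.T.map u))
    -- `ω` is a classifying map of `Tu`; it is tight, and a strict algebra structure
    (ω : M.T.obj Ω ⟶ Ω) (ωpt : M.T.obj Ωpt ⟶ Ωpt) (hω : IsTwoPullback (M.T.map u) ωpt ω u)
    (hω_tight : IsTight ω) (hω_unit : M.i Ω ≫ ω = 𝟙 Ω)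
    (hω_assoc : M.m Ω ≫ ω = M.T.map ω ≫ ω) :
    ∃ (ht : IsTight ωpt) (h₁ : M.i Ωpt ≫ ωpt = 𝟙 Ωpt)
      (h₂ : M.m Ωpt ≫ ωpt = M.T.map ωpt ≫ ωpt),
      let A : Alg M := ⟨Ω, ω, hω_tight, hω_unit, hω_assoc⟩
      let Apt : Alg M := ⟨Ωpt, ωpt, ht, h₁, h₂⟩
      let U : Apt ⟶ A := Alg.LaxHom.ofStrict u hω.w
      IsRepresentablePlumbus (K := Alg M) (Alg.Small Small) U ∧
      ∀ {E B : Alg M} (p : E ⟶ B), Alg.Small Small p →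
        (∀ (d : B.carrier ⟶ Ω) (x : E.carrier ⟶ Ωpt), IsTwoPullback p.hom x d u →
          ∃! D : B ⟶ A, D.hom = d ∧ ∃ X : E ⟶ Apt, X.hom = x ∧ IsTwoPullback p X D U) ∧
        (∀ (D : B ⟶ A) (X : E ⟶ Apt), IsTwoPullback p X D U →
          IsTwoPullback (M.T.map p.hom) (M.T.map X.hom ≫ ωpt) (M.T.map D.hom ≫ ω) u ∧
          ∀ {P : K} (fst : P ⟶ M.T.obj B.carrier) (snd : P ⟶ E.carrier)
            (δ : M.T.obj E.carrier ⟶ P), Alg.IsCartesianityDefect p fst snd δ →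
            IsTwoPullback fst (snd ≫ X.hom) (B.str ≫ D.hom) u ∧
            Classifies u (M.T.map p.hom) (M.T.map X.hom ≫ ωpt) fst (snd ≫ X.hom) D.laxator δ) := by
  obtain ⟨ht, h₁, h₂⟩ := hK.algebra_structure hT hω hω_tight hω_unit hω_assoc
  refine ⟨ht, h₁, h₂, ?_⟩
  intro A Apt U
  have hU : Alg.LaxHom.IsStrict U := Alg.LaxHom.isStrict_ofStrict (A := Apt) (B := A) u hω.w
  refine ⟨Alg.isRepresentablePlumbus (U := U) hK hU hT hω, fun {E B} p hp => ⟨fun d x H => ?_,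
    fun D X H => ?_⟩⟩
  · exact Alg.exists_classifying (U := U) hK hU hT hω hp.1.tight.1 hp.1.tight.2 H
  · have H' := Alg.isTwoPullback_hom hK.isPlumbus (Alg.isTightDopf_classifier (U := U) hK hU) H
    refine ⟨hK.map_pullback hT hω H' hp.1.tight.2, fun {P} fst snd δ hδ => ?_⟩
    -- The laxator of `X` already lifts `Tp ◁ D.laxator`. Its end `E.str ≫ X.hom` factors through
    -- `P` by the defining property of the defect, so it exhibits `δ` as the classified map.
    obtain ⟨l, hl⟩ := TwoCellEq.exists_congr rfl
      (show E.str ≫ X.hom = δ ≫ snd ≫ X.hom by rw [← Strict.assoc, hδ.snd_eq]) X.laxator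
    exact ⟨hδ.isTwoPullback.paste H', hδ.fst_eq, l, (TwoCellEq.whiskerRight rfl hl).trans
      (Alg.laxator_lift (U := U) hU hp.1.tight.1 H.w)⟩
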